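/- Let $\Phi$ be a special Bernstein function, that is, $\Phi$ and $\lambda\mapsto\lambda/\Phi(\lambda)$ are both Bernstein functions on $(0,\infty)$, with Lévy–Khintchine representation $\Phi(\lambda)=\int_0^\infty(1-e^{-\lambda x})\,\nu_\Phi(dx)$ (no constant and no linear term), where $\nu_\Phi$ is a measure on $(0,\infty)$ with $\int_0^\infty(1\wedge x)\,\nu_\Phi(dx)<\infty$ and $\nu_\Phi(0,\infty)=\infty$. Let $\sigma_\Phi$ be the subordinator with $\mathbb E[e^{-\lambda\sigma_\Phi(t)}]=e^{-t\Phi(\lambda)}$, let $U_\Phi(A)=\mathbb E\big[\int_0^\infty \mathbf 1_A(\sigma_\Phi(s))\,ds\big]$ be its potential measure, $U_\Phi(t)=U_\Phi(0,t)$, and let $u_\Phi$ be the potential density, i.e. the nonnegative nonincreasing function on $(0,\infty)$ with $U_\Phi(dt)=u_\Phi(t)\,dt$. Suppose that there are $t_0>0$, $C>0$ and $\beta\in(0,1)$ with $u_\Phi(t)\le C\,t^{\beta-1}$ for all $t\in(0,t_0)$. For $r\ge 0$ put $$T_\Phi(r)=U_\Phi^{\leftarrow}(1/r),\qquad U_\Phi^{\leftarrow}(v)=\min\{x\ge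 0:\ U_\Phi(x)\ge v\},$$ with $T_\Phi(0)=\infty$. Then $T_\Phi(r)>0$ for every $r\ge0$. Let $X$ be a Banach space, $F:X\to X$ a bounded linear operator, $\xi,f_0\in X$. Then on $J=[0,T)$ with $T=T_\Phi(\|F\|)$, which besides $\Phi$ depends only on the operator norm of $F$, and more generally on $J=[0,T)$ for every $0<T\le T_\Phi(\|F\|)$, the problem $$\partial_t^\Phi f(t)=\xi+Ff(t),\quad t\in J,\qquad f(0)=f_0,$$ where $$\partial_t^\Phi f(t)=\frac{d}{dt}\int_0^t\nu_\Phi(t-s,\infty)\,(f(s)-f(0))\,ds ,$$ has a unique solution $f\in C^\beta(J,X)$. Here $C^\beta(J,X)$ is the space of functions that are Hölder continuous of order $\beta$ on $J$ if $T<\infty$, and on every bounded subinterval $[0,S)$ if $T=\infty$ (which can happen only for $F=0$). The solution satisfies the equation at every $t\in J$ (with the one-sided derivative at $t=0$), and it is unique in $C^\beta(J,X)$ even among the functions with $f(0)=f_0$ that satisfy the equation only for almost every $t\in J$ and for which the integral in the definition of $\partial_t^\Phi f$ is a locally absolutely continuous function of $t\in J$. -/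

import Mathlib

open Set MeasureTheory ProbabilityTheory
open scoped NNReal ENNReal

noncomputable section

namespace GenCaputo

/-! ### Bernstein functions -/

/-- Bernstein functions on `(0,∞)`; the values of `Φ` outside `(0,∞)` play no role. -/
structure IsBernstein (Φ : ℝ → ℝ) : Prop where
  smooth : ContDiffOn ℝ ((⊤ : ℕ∞) : WithTop ℕ∞) Φ (Ioi 0)
  nonneg : ∀ x, 0 < x → 0 ≤ Φ x
  deriv_sign : ∀ n : ℕ, 1 ≤ n → ∀ x, 0 < x → (-1 : ℝ) ^ n * iteratedDeriv n Φ x ≤ 0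

/-- Special Bernstein functions: the conjugate `x ↦ x / Φ x` is defined and again Bernstein. -/
structure IsSpecialBernstein (Φ : ℝ → ℝ) : Prop where
  bernstein : IsBernstein Φ
  ne_zero : ∀ x, 0 < x → Φ x ≠ 0
  conj : IsBernstein (fun x => x / Φ x)

/-- `(a, b, ν)` is the Lévy triplet of `Φ`; `ν` is a measure on `(0,∞)`, written as a measure
on `ℝ` without mass on `(-∞,0]`. -/
structure IsLevyTriplet (Φ : ℝ → ℝ) (a b : ℝ) (ν : Measure ℝ) : Prop where
  drift_nonneg : 0 ≤ b
  killing_nonneg : 0 ≤ a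
  supported : ν (Iic 0) = 0
  integrability : ∫⁻ x in Ioi (0 : ℝ), ENNReal.ofReal (min 1 x) ∂ν < ⊤
  repr : ∀ l, 0 < l → Φ l = a + b * l + ∫ x in Ioi (0 : ℝ), (1 - Real.exp (-(l * x))) ∂ν

/-- The tail `t ↦ ν(t,∞)` of a Lévy measure; it is finite for `t > 0`. -/
def tail (ν : Measure ℝ) (t : ℝ) : ℝ := (ν (Ioi t)).toReal

/-! ### Subordinators and their potential measures -/

/-- A subordinator: a Lévy process on the probability space `(Ω, P)` with nondecreasing
paths. (Left limits and stochastic continuity are automatic.) -/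
structure IsSubordinator {Ω : Type*} [MeasurableSpace Ω] (P : Measure Ω)
    (σ : ℝ≥0 → Ω → ℝ) : Prop where
  measurable : ∀ t, Measurable (σ t)
  zero : ∀ᵐ ω ∂P, σ 0 ω = 0
  mono : ∀ᵐ ω ∂P, Monotone (fun t => σ t ω)
  rightCont : ∀ᵐ ω ∂P, ∀ t, ContinuousWithinAt (fun s => σ s ω) (Ici t) t
  indep : HasIndepIncrements σ P
  stationary : ∀ s t, IdentDistrib (fun ω => σ (s + t) ω - σ s ω) (σ t) P P

/-- `σ` has Laplace exponent `Φ`: `E[exp(-l σ(t))] = exp(-t Φ(l))`. -/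
def HasLaplaceExponent {Ω : Type*} [MeasurableSpace Ω] (P : Measure Ω)
    (σ : ℝ≥0 → Ω → ℝ) (Φ : ℝ → ℝ) : Prop :=
  ∀ t : ℝ≥0, ∀ l : ℝ, 0 < l →
    ∫ ω, Real.exp (-(l * σ t ω)) ∂P = Real.exp (-((t : ℝ) * Φ l))

/-- The potential measure `A ↦ E[∫₀^∞ 1_A(σ(s)) ds]`, that is, the image of `P ⊗ ds` under
`(ω, s) ↦ σ(s)(ω)` (which is almost everywhere measurable, by right-continuity). -/
def potentialMeasure {Ω : Type*} [MeasurableSpace Ω] (P : Measure Ω)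
    (σ : ℝ≥0 → Ω → ℝ) : Measure ℝ :=
  (P.prod ((volume : Measure ℝ).restrict (Ici 0))).map (fun p => σ p.2.toNNReal p.1)

/-- `u` is the potential density: the nonnegative nonincreasing function on `(0,∞)`, integrable
near `0`, with `U(dt) = u(t) dt` on `[0,∞)`. -/
structure IsPotentialDensity (U : Measure ℝ) (u : ℝ → ℝ) : Prop where
  nonneg : ∀ t, 0 < t → 0 ≤ u t
  antitone : AntitoneOn u (Ioi 0)
  integrable : IntegrableOn u (Ioo 0 1)
  density : U = ((volume : Measure ℝ).restrict (Ioi 0)).withDensity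
    (fun t => ENNReal.ofReal (u t))

/-- The left-continuous inverse `v ↦ min {x ≥ 0 : U(x) ≥ v}` of the distribution function
`U(x) = U(0,x)`, with value `∞` where there is no such `x` (in particular at `v = ∞` if `U(x)`
is finite for all `x`). -/
def leftInverse (U : Measure ℝ) (v : ℝ≥0∞) : ℝ≥0∞ :=
  ⨅ (x : ℝ≥0) (_ : v ≤ U (Ioo 0 (x : ℝ))), (x : ℝ≥0∞)

/-- The existence time `U^←(1/r)`, as a function of the operator norm `r`, with `1/0 = ∞`. -/
def existenceTime (U : Measure ℝ) (r : ℝ≥0∞) : ℝ≥0∞ := leftInverse U r⁻¹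

/-! ### The generalized Caputo derivative and the Cauchy problem -/

variable {X : Type*} [NormedAddCommGroup X] [NormedSpace ℝ X]

/-- The function `t ↦ ∫₀ᵗ ν(t-s,∞) (f(s) - f(0)) ds`. -/
def caputoIntegral (ν : Measure ℝ) (f : ℝ → X) (t : ℝ) : X :=
  ∫ s in (0 : ℝ)..t, tail ν (t - s) • (f s - f 0)

/-- The generalized Caputo derivative of `f` at `t ≥ 0` exists and equals `v`
(a one-sided derivative at `t = 0`). -/
def HasCaputoDerivAt (ν : Measure ℝ) (f : ℝ → X) (v : X) (t : ℝ) : Prop :=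
  HasDerivWithinAt (caputoIntegral ν f) v (Ici 0) t

/-- The interval `[0,T)`, where `T` may be `∞`. -/
def timeInterval (T : ℝ≥0∞) : Set ℝ := {t | 0 ≤ t ∧ ENNReal.ofReal t < T}

/-- `f` solves `∂ₜ^Φ f(t) = G(f(t))` for almost every `t ∈ [0,T)`, `f(0) = f₀`. As usual for an
equation that holds almost everywhere, the function which is differentiated has to be (locally)
absolutely continuous. If `f` and `G` are continuous this is the case for every `f` that satisfies
the equation at all `t ∈ [0,T)`, since then that function is continuously differentiable. -/
structure IsSolution (ν : Measure ℝ) (G : X → X) (f₀ : X) (T : ℝ≥0∞) (f : ℝ → X) : Prop where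
  init : f 0 = f₀
  integrable : ∀ t ∈ timeInterval T,
    IntervalIntegrable (fun s => tail ν (t - s) • (f s - f 0)) volume 0 t
  absCont : ∀ t ∈ timeInterval T, AbsolutelyContinuousOnInterval (caputoIntegral ν f) 0 t
  eqn : ∀ᵐ t : ℝ, t ∈ timeInterval T → HasCaputoDerivAt ν f (G (f t)) t

/-- `f ∈ C^β([0,T),X)`: Hölder continuous of order `β` on `[0,T)` if `T` is finite, and on every
bounded subinterval `[0,S)` if `T = ∞`. -/
def IsHolder (β : ℝ) (T : ℝ≥0∞) (f : ℝ → X) : Prop :=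
  ∀ S : ℝ≥0∞, S < ⊤ → S ≤ T → ∃ L : ℝ, ∀ t ∈ timeInterval S, ∀ s ∈ timeInterval S,
    ‖f t - f s‖ ≤ L * |t - s| ^ β

end GenCaputo

end

/-! Write `k = tail ν`. By the definition of the potential measure, the Laplace transform of `u` is
`1/Φ(l)`; by Fubini in the Lévy–Khintchine formula, that of `k` is `Φ(l)/l`. Their product is `1/l`,
so injectivity of the Laplace transform gives the Sonine relation `u * k = 1`
(`IsPotentialDensity.isSoninePair`). Convolution with `u` therefore inverts the Caputo operator:
with `v = f - f₀` and `η = ξ + F f₀`, the equation integrated in time reads `k * v = 1 * (η + F v)`,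
which is equivalent to the Volterra equation `v = u * (η + F v)`.

Multiplication by `exp(-l x)` commutes with convolution, so the Volterra equation can be solved for
weighted kernels. The weighted mass of `u` tends to `0` as `l → ∞`, hence for large `l` the
right-hand side is a contraction on bounded continuous functions on the whole line. Removing the
weight yields a solution on all of `[0,∞)` (`IsSoninePair.exists_solution`); the same contraction
applied to a difference of solutions gives uniqueness (`IsSoninePair.eq_zero_of_integral_eq`).

Hölder regularity comes from monotonicity of `u`: a shift by `d` changes the kernel in `L¹` by at
most `2 ∫₀ᵈ u`, which is of order `d ^ β` (`norm_conv_sub_le`). An almost everywhere solution is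
reduced to the integrated equation by absolute continuity (`IsSolution.caputoIntegral_eq`). -/

noncomputable section

namespace GenCaputo

open Filter Topology

/-! ### Convolution on the line with integrable causal kernels -/

section Conv

variable {X : Type*} [NormedAddCommGroup X] [NormedSpace ℝ X]

/-- The convolution of a scalar kernel with a vector-valued function on the real line. -/
def conv (a : ℝ → ℝ) (f : ℝ → X) (t : ℝ) : X := ∫ r, a r • f (t - r)

/-- The kernel `r ↦ exp(-l r) a(r)` on `(0,∞)`, extended by zero. -/
def expWeight (l : ℝ) (a : ℝ → ℝ) : ℝ → ℝ :=
  (Ioi 0).indicator fun r => Real.exp (-(l * r)) * a r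

lemma expWeight_of_pos {l r : ℝ} (a : ℝ → ℝ) (hr : 0 < r) :
    expWeight l a r = Real.exp (-(l * r)) * a r := indicator_of_mem (by exact hr) _

lemma expWeight_of_nonpos {l r : ℝ} (a : ℝ → ℝ) (hr : r ≤ 0) : expWeight l a r = 0 :=
  indicator_of_notMem (by simpa using hr) _

lemma expWeight_nonneg {l : ℝ} {a : ℝ → ℝ} (ha : ∀ r, 0 < r → 0 ≤ a r) (r : ℝ) :
    0 ≤ expWeight l a r :=
  indicator_nonneg (fun r hr => mul_nonneg (Real.exp_pos _).le (ha r hr)) r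

lemma aestronglyMeasurable_comp_sub_left {X : Type*} [NormedAddCommGroup X] {f : ℝ → X}
    (hf : AEStronglyMeasurable f) (t : ℝ) : AEStronglyMeasurable fun r => f (t - r) :=
  hf.comp_quasiMeasurePreserving (quasiMeasurePreserving_sub_left volume t)

lemma integrable_conv {a : ℝ → ℝ} {f : ℝ → X} {M : ℝ} (ha : Integrable a)
    (hf : AEStronglyMeasurable f) (hM : ∀ x, ‖f x‖ ≤ M) (t : ℝ) :
    Integrable fun r => a r • f (t - r) :=
  ha.smul_bdd M (aestronglyMeasurable_comp_sub_left hf t) (Eventually.of_forall fun _ => hM _)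

lemma norm_conv_le {a : ℝ → ℝ} {f : ℝ → X} {M t : ℝ} (ha : Integrable a)
    (ha_nn : ∀ r, 0 ≤ a r) (ha0 : ∀ r < 0, a r = 0) (hM : ∀ x ≤ t, ‖f x‖ ≤ M) :
    ‖conv a f t‖ ≤ (∫ r, a r) * M := by
  rw [conv, ← integral_mul_const]
  refine norm_integral_le_of_norm_le (ha.mul_const M) (Eventually.of_forall fun r => ?_)
  rw [norm_smul, Real.norm_of_nonneg (ha_nn r)]
  rcases lt_or_ge r 0 with hr | hr
  · simp [ha0 r hr]
  · exact mul_le_mul_of_nonneg_left (hM _ (by linarith)) (ha_nn r)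

/-- Causality: a kernel without mass on the negative half-line sees only the past of `f`. -/
lemma conv_congr_Iic {a : ℝ → ℝ} {f g : ℝ → X} {t : ℝ} (ha0 : ∀ r < 0, a r = 0)
    (h : ∀ x ≤ t, f x = g x) : conv a f t = conv a g t := by
  refine integral_congr_ae (Eventually.of_forall fun r => ?_)
  rcases lt_or_ge r 0 with hr | hr
  · simp [ha0 r hr]
  · simp only [h (t - r) (by linarith)]

lemma conv_congr_left {a b : ℝ → ℝ} (h : a =ᵐ[volume] b) (f : ℝ → X) : conv a f = conv b f := by
  ext t
  refine integral_congr_ae ?_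
  filter_upwards [h] with r hr
  simp only [hr]

lemma conv_sub {a : ℝ → ℝ} {f g : ℝ → X} {M N : ℝ} (ha : Integrable a)
    (hf : AEStronglyMeasurable f) (hM : ∀ x, ‖f x‖ ≤ M)
    (hg : AEStronglyMeasurable g) (hN : ∀ x, ‖g x‖ ≤ N) (t : ℝ) :
    conv a (fun x => f x - g x) t = conv a f t - conv a g t := by
  simp only [conv, smul_sub]
  exact integral_sub (integrable_conv ha hf hM t) (integrable_conv ha hg hN t)

/-- Fubini after the translation `q = p - r`. Joint integrability holds because `a r * b (p - r)` is
integrable on the plane and the remaining factor is bounded. -/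
lemma conv_assoc [CompleteSpace X] {a b : ℝ → ℝ} {f : ℝ → X} {M : ℝ} (ha : Integrable a)
    (hb : Integrable b) (hf : AEStronglyMeasurable f) (hM : ∀ x, ‖f x‖ ≤ M) (t : ℝ) :
    conv a (conv b f) t = conv (conv a b) f t := by
  have hint : Integrable (fun p : ℝ × ℝ => (a p.2 * b (p.1 - p.2)) • f (t - p.1))
      (volume.prod volume) := by
    have h := ha.convolution_integrand (ContinuousLinearMap.mul ℝ ℝ) hb
    simp only [ContinuousLinearMap.mul_apply'] at h
    exact h.smul_bdd M (aestronglyMeasurable_comp_sub_left hf t).comp_fst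
      (Eventually.of_forall fun _ => hM _)
  calc conv a (conv b f) t = ∫ r, ∫ p, (a r * b (p - r)) • f (t - p) := by
        refine integral_congr_ae (Eventually.of_forall fun r => ?_)
        simp only [conv, mul_smul, integral_smul]
        rw [← integral_sub_right_eq_self (fun q => b q • f (t - r - q)) r]
        simp only [sub_sub, add_sub_cancel]
    _ = ∫ p, ∫ r, (a r * b (p - r)) • f (t - p) := (integral_integral_swap hint).symm
    _ = conv (conv a b) f t := by
        refine integral_congr_ae (Eventually.of_forall fun p => ?_)
        simp only [conv, integral_smul_const, smul_eq_mul]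

/-- A discontinuity of `f` at the single point `s` is seen only at `r = t - s`, a null set. It is
admitted because the forcing term of the Volterra equation jumps at `0`. -/
lemma continuous_conv {a : ℝ → ℝ} {f : ℝ → X} {M : ℝ} (ha : Integrable a)
    (hf : AEStronglyMeasurable f) (hM : ∀ x, ‖f x‖ ≤ M) {s : ℝ}
    (hc : ∀ x, x ≠ s → ContinuousAt f x) : Continuous (conv a f) := by
  refine continuous_iff_continuousAt.2 fun t => ?_
  refine continuousAt_of_dominated (bound := fun r => ‖a r‖ * M)
    (Eventually.of_forall fun x => (integrable_conv ha hf hM x).aestronglyMeasurable)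
    (Eventually.of_forall fun x => Eventually.of_forall fun r => ?_) (ha.norm.mul_const M) ?_
  · rw [norm_smul]
    exact mul_le_mul_of_nonneg_left (hM _) (norm_nonneg _)
  · have : ∀ᵐ r : ℝ, r ≠ t - s := by simp [ae_iff]
    filter_upwards [this] with r hr
    have h1 : ContinuousAt f (t - r) := hc _ fun h => hr (by linarith)
    have h2 : ContinuousAt (fun x : ℝ => x - r) t := by fun_prop
    exact continuousAt_const.smul (ContinuousAt.comp (g := f) h1 h2)

/-- The source of Hölder continuity. The difference equals the integral of `a (r + d) - a r` against
`f (s - r)`. Since `a` decreases on `(0,∞)`, this difference of kernels is positive only on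
`(-d,0]`, where it has mass `∫₀ᵈ a`; its total integral is zero, so its `L¹` norm is twice that
mass. -/
lemma norm_conv_sub_le {a : ℝ → ℝ} {f : ℝ → X} {M : ℝ} (ha : Integrable a)
    (ha_nn : ∀ r, 0 ≤ a r) (ha0 : ∀ r ≤ 0, a r = 0) (hanti : AntitoneOn a (Ioi 0))
    (hf : AEStronglyMeasurable f) (hM : ∀ x, ‖f x‖ ≤ M) {s t : ℝ} (hst : s ≤ t) :
    ‖conv a f t - conv a f s‖ ≤ 2 * M * ∫ r in 0..(t - s), a r := by
  have hM0 : 0 ≤ M := (norm_nonneg _).trans (hM 0)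
  set d := t - s with hd
  have hd0 : 0 ≤ d := by linarith
  have ha' : Integrable fun r => a (r + d) := ha.comp_add_right d
  have hrep : conv a f t - conv a f s = ∫ r, (a (r + d) - a r) • f (s - r) := by
    have h1 : conv a f t = ∫ r, a (r + d) • f (s - r) := by
      rw [conv, ← integral_add_right_eq_self _ d]
      refine integral_congr_ae (Eventually.of_forall fun r => ?_)
      simp only [hd]
      congr 2
      ring
    have h2 : Integrable fun r => a (r + d) • f (s - r) := integrable_conv ha' hf hM s
    rw [h1, conv, ← integral_sub h2 (integrable_conv ha hf hM s)]
    simp only [sub_smul]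
  have hind : Integrable ((Ioc (-d) 0).indicator fun r => a (r + d)) :=
    ha'.indicator measurableSet_Ioc
  have hbd : Integrable fun r => (a r - a (r + d)
      + 2 * (Ioc (-d) 0).indicator (fun r => a (r + d)) r) * M :=
    ((ha.sub ha').add (hind.const_mul 2)).mul_const M
  have hval : ∫ r, (a r - a (r + d) + 2 * (Ioc (-d) 0).indicator (fun r => a (r + d)) r) * M
      = 2 * M * ∫ r in 0..d, a r := by
    have h3 : ∫ r, (a r - a (r + d)) = 0 := by
      rw [integral_sub ha ha', integral_add_right_eq_self a d, sub_self]
    have h4 : ∫ r, (Ioc (-d) 0).indicator (fun r => a (r + d)) r = ∫ r in 0..d, a r := by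
      rw [integral_indicator measurableSet_Ioc, ← intervalIntegral.integral_of_le (by linarith),
        intervalIntegral.integral_comp_add_right]
      simp
    rw [integral_mul_const, integral_add (f := fun r => a r - a (r + d)) (ha.sub ha')
      (hind.const_mul 2), h3,
      integral_const_mul, h4]
    ring
  rw [hrep, ← hval]
  refine norm_integral_le_of_norm_le hbd (Eventually.of_forall fun r => ?_)
  rw [norm_smul]
  -- Both remaining goals are the same pointwise bound; the second copy yields nonnegativity of the
  -- dominating factor.
  refine mul_le_mul ?_ (hM _) (norm_nonneg _) ((norm_nonneg (a (r + d) - a r)).trans ?_) <;>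
  · rw [Real.norm_eq_abs, abs_le]
    by_cases hr : r ∈ Ioc (-d) 0
    · rw [indicator_of_mem hr, ha0 r hr.2]
      have := ha_nn (r + d)
      constructor <;> linarith
    · rw [indicator_of_notMem hr]
      rcases lt_or_ge 0 r with h | h
      · have := hanti (mem_Ioi.2 h) (mem_Ioi.2 (by linarith : 0 < r + d)) (by linarith)
        constructor <;> linarith
      · have h5 : r ≤ -d := by
          by_contra h6
          exact hr ⟨not_le.1 h6, h⟩
        rw [ha0 r h, ha0 (r + d) (by linarith)]
        simp

end Conv

/-! ### Volterra equations with a kernel of small mass -/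

section FixedPoint

variable {X : Type*} [NormedAddCommGroup X] [NormedSpace ℝ X]

/-- A bounded continuous solution of the homogeneous Volterra equation on `(-∞,T]` vanishes. -/
lemma eq_zero_of_eq_conv {a : ℝ → ℝ} (ha : Integrable a) (ha_nn : ∀ r, 0 ≤ a r)
    (ha0 : ∀ r < 0, a r = 0) (F : X →L[ℝ] X) (hF : ‖F‖ * ∫ r, a r < 1) {w : ℝ → X} {M T : ℝ}
    (hM : ∀ x ≤ T, ‖w x‖ ≤ M) (h : ∀ t ≤ T, w t = conv a (fun x => F (w x)) t) :
    ∀ t ≤ T, w t = 0 := by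
  set q := ‖F‖ * ∫ r, a r with hq
  have hq0 : 0 ≤ q := mul_nonneg (norm_nonneg _) (integral_nonneg ha_nn)
  have key : ∀ n : ℕ, ∀ t ≤ T, ‖w t‖ ≤ q ^ n * M := by
    intro n
    induction n with
    | zero => simpa using hM
    | succ n ih =>
      intro t ht
      rw [h t ht]
      refine (norm_conv_le (M := ‖F‖ * (q ^ n * M)) ha ha_nn ha0 fun x hx => ?_).trans_eq ?_
      · exact (F.le_opNorm _).trans
          (mul_le_mul_of_nonneg_left (ih x (hx.trans ht)) (norm_nonneg _))
      · rw [hq]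
        ring
  intro t ht
  have hlim : Tendsto (fun n : ℕ => q ^ n * M) atTop (𝓝 (0 * M)) :=
    (tendsto_pow_atTop_nhds_zero_of_lt_one hq0 hF).mul_const M
  rw [zero_mul] at hlim
  exact norm_le_zero_iff.1 (ge_of_tendsto' hlim fun n => key n t ht)

open BoundedContinuousFunction in
/-- The Volterra equation `w = a * (p + F w)` has a bounded continuous solution if
`‖F‖ ∫ a < 1`. -/
lemma exists_eq_conv [CompleteSpace X] {a : ℝ → ℝ} (ha : Integrable a) (ha_nn : ∀ r, 0 ≤ a r)
    (ha0 : ∀ r < 0, a r = 0) (F : X →L[ℝ] X) (hF : ‖F‖ * ∫ r, a r < 1) {p : ℝ → X} {M s : ℝ}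
    (hp : AEStronglyMeasurable p) (hM : ∀ x, ‖p x‖ ≤ M) (hc : ∀ x, x ≠ s → ContinuousAt p x) :
    ∃ w : ℝ → X, Continuous w ∧ (∃ N, ∀ x, ‖w x‖ ≤ N) ∧
      ∀ t, w t = conv a (fun x => p x + F (w x)) t := by
  have hq0 : 0 ≤ ‖F‖ * ∫ r, a r := mul_nonneg (norm_nonneg _) (integral_nonneg ha_nn)
  have hbd : ∀ (w : ℝ →ᵇ X) x, ‖p x + F (w x)‖ ≤ M + ‖F‖ * ‖w‖ := fun w x =>
    norm_add_le_of_le (hM x) ((F.le_opNorm _).trans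
      (mul_le_mul_of_nonneg_left (w.norm_coe_le_norm x) (norm_nonneg _)))
  have hms : ∀ w : ℝ →ᵇ X, AEStronglyMeasurable fun x => p x + F (w x) := fun w =>
    hp.add (F.continuous.comp w.continuous).aestronglyMeasurable
  have hcont : ∀ w : ℝ →ᵇ X, Continuous (conv a fun x => p x + F (w x)) := fun w =>
    continuous_conv ha (hms w) (hbd w) fun x hx =>
      (hc x hx).add (F.continuous.comp w.continuous).continuousAt
  let Ψ : (ℝ →ᵇ X) → (ℝ →ᵇ X) := fun w =>
    BoundedContinuousFunction.ofNormedAddCommGroup (conv a fun x => p x + F (w x)) (hcont w)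
      ((∫ r, a r) * (M + ‖F‖ * ‖w‖)) fun t => norm_conv_le ha ha_nn ha0 fun x _ => hbd w x
  have hΨ : ContractingWith ⟨‖F‖ * ∫ r, a r, hq0⟩ Ψ := by
    refine ⟨by exact_mod_cast hF, LipschitzWith.of_dist_le_mul fun v w => ?_⟩
    refine (BoundedContinuousFunction.dist_le (mul_nonneg hq0 dist_nonneg)).2 fun t => ?_
    change dist (conv a (fun x => p x + F (v x)) t) (conv a (fun x => p x + F (w x)) t) ≤ _
    rw [dist_eq_norm, ← conv_sub ha (hms v) (hbd v) (hms w) (hbd w)]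
    refine (norm_conv_le (M := ‖F‖ * dist v w) ha ha_nn ha0 fun x _ => ?_).trans_eq ?_
    · rw [add_sub_add_left_eq_sub, ← map_sub]
      refine (F.le_opNorm _).trans (mul_le_mul_of_nonneg_left ?_ (norm_nonneg _))
      rw [← dist_eq_norm]
      exact v.dist_coe_le_dist x
    · change _ = (‖F‖ * ∫ r, a r) * dist v w
      ring
  refine ⟨_, (ContractingWith.fixedPoint Ψ hΨ).continuous,
    ⟨_, (ContractingWith.fixedPoint Ψ hΨ).norm_coe_le_norm⟩, fun t => ?_⟩
  have h := congrArg (fun w : ℝ →ᵇ X => w t) hΨ.fixedPoint_isFixedPt.symm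
  exact h

end FixedPoint

/-! ### Injectivity of the Laplace transform and the Sonine relation -/

section Laplace

lemma interior_integrableExpSet_of_Ioo {μ : Measure ℝ} {δ : ℝ}
    (h : ∀ s ∈ Ioo (-δ) δ, Integrable (fun x => Real.exp (s * x)) μ) :
    Ioo (-δ) δ ⊆ interior (integrableExpSet id μ) :=
  interior_maximal (fun s hs => h s hs) isOpen_Ioo

/-- Finite measures on the line whose moment generating functions are finite and agree near the
origin are equal. -/
lemma measure_eq_of_mgf_eq_near_zero {μ μ' : Measure ℝ} [IsFiniteMeasure μ] [IsFiniteMeasure μ']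
    {δ : ℝ} (hδ : 0 < δ) (hμ : ∀ s ∈ Ioo (-δ) δ, Integrable (fun x => Real.exp (s * x)) μ)
    (hμ' : ∀ s ∈ Ioo (-δ) δ, Integrable (fun x => Real.exp (s * x)) μ')
    (h : ∀ s ∈ Ioo (-δ) δ, mgf id μ s = mgf id μ' s) : μ = μ' := by
  -- Both complex moment generating functions are analytic on this strip and agree on its real
  -- points near `0`. By the identity theorem they agree on the imaginary axis, where they are the
  -- characteristic functions.
  let D : Set ℂ := {z | z.re ∈ Ioo (-δ) δ}
  have hA : AnalyticOnNhd ℂ (complexMGF id μ) D :=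
    analyticOnNhd_complexMGF.mono fun z hz => interior_integrableExpSet_of_Ioo hμ hz
  have hA' : AnalyticOnNhd ℂ (complexMGF id μ') D :=
    analyticOnNhd_complexMGF.mono fun z hz => interior_integrableExpSet_of_Ioo hμ' hz
  have h0 : (0 : ℝ) ∈ Ioo (-δ) δ := ⟨by linarith, hδ⟩
  have hconn : IsPreconnected D :=
    ((convex_Ioo (-δ) δ).linear_preimage Complex.reLm).isPreconnected
  have hfreq : ∃ᶠ z in 𝓝[≠] (0 : ℂ), complexMGF id μ z = complexMGF id μ' z := by
    have hev : ∀ᶠ x : ℝ in 𝓝[≠] 0, complexMGF id μ x = complexMGF id μ' x := by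
      filter_upwards [mem_nhdsWithin_of_mem_nhds (isOpen_Ioo.mem_nhds h0)] with x hx
      rw [complexMGF_ofReal, complexMGF_ofReal, h x hx]
    have htend : Tendsto (fun x : ℝ => (x : ℂ)) (𝓝[≠] 0) (𝓝[≠] 0) := by
      refine tendsto_nhdsWithin_iff.2 ⟨?_, ?_⟩
      · exact (Complex.continuous_ofReal.tendsto' 0 0 (by simp)).mono_left nhdsWithin_le_nhds
      · filter_upwards [self_mem_nhdsWithin] with x hx
        simpa using hx
    exact htend.frequently hev.frequently
  have heq := AnalyticOnNhd.eqOn_of_preconnected_of_frequently_eq hA hA' hconn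
    (z₀ := 0) (by simpa [D] using hδ) hfreq
  refine Measure.ext_of_charFun (funext fun t => ?_)
  rw [← complexMGF_id_mul_I, ← complexMGF_id_mul_I]
  exact heq (by simpa [D] using hδ)

/-- Injectivity of the two-sided Laplace transform on nonnegative functions. -/
lemma ae_eq_of_integral_exp_mul_eq {a b : ℝ → ℝ} {δ : ℝ} (hδ : 0 < δ)
    (ha_nn : ∀ x, 0 ≤ a x) (hb_nn : ∀ x, 0 ≤ b x)
    (ha : ∀ s ∈ Ioo (-δ) δ, Integrable fun x => Real.exp (s * x) * a x)
    (hb : ∀ s ∈ Ioo (-δ) δ, Integrable fun x => Real.exp (s * x) * b x)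
    (h : ∀ s ∈ Ioo (-δ) δ, ∫ x, Real.exp (s * x) * a x = ∫ x, Real.exp (s * x) * b x) :
    a =ᵐ[volume] b := by
  have h0 : (0 : ℝ) ∈ Ioo (-δ) δ := ⟨by linarith, hδ⟩
  have ha0 : Integrable a := by simpa using ha 0 h0
  have hb0 : Integrable b := by simpa using hb 0 h0
  have key : ∀ {c : ℝ → ℝ}, (∀ x, 0 ≤ c x) → Integrable c → ∀ s : ℝ,
      Integrable (fun x => Real.exp (s * x) * c x) →
      Integrable (fun x => Real.exp (s * x)) (volume.withDensity fun x => ENNReal.ofReal (c x)) ∧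
      mgf id (volume.withDensity fun x => ENNReal.ofReal (c x)) s
        = ∫ x, Real.exp (s * x) * c x := by
    intro c hc hci s hs
    have hm : AEMeasurable (fun x => ENNReal.ofReal (c x)) := hci.aemeasurable.ennreal_ofReal
    have hfin : ∀ᵐ x : ℝ, ENNReal.ofReal (c x) < ⊤ := Eventually.of_forall fun x => by simp
    have hr : (fun x => (ENNReal.ofReal (c x)).toReal • Real.exp (s * x))
        = fun x => Real.exp (s * x) * c x := by
      ext x
      rw [ENNReal.toReal_ofReal (hc x), smul_eq_mul, mul_comm]
    constructor
    · rw [integrable_withDensity_iff_integrable_smul₀' hm hfin, hr]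
      exact hs
    · simp only [mgf, id]
      rw [integral_withDensity_eq_integral_toReal_smul₀ hm hfin, hr]
  have hfa : IsFiniteMeasure (volume.withDensity fun x => ENNReal.ofReal (a x)) :=
    isFiniteMeasure_withDensity_ofReal ha0.2
  have hfb : IsFiniteMeasure (volume.withDensity fun x => ENNReal.ofReal (b x)) :=
    isFiniteMeasure_withDensity_ofReal hb0.2
  have hμ := measure_eq_of_mgf_eq_near_zero hδ
    (fun s hs => (key ha_nn ha0 s (ha s hs)).1) (fun s hs => (key hb_nn hb0 s (hb s hs)).1)
    (fun s hs => by rw [(key ha_nn ha0 s (ha s hs)).2, (key hb_nn hb0 s (hb s hs)).2, h s hs])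
  rw [withDensity_eq_iff_of_sigmaFinite ha0.aemeasurable.ennreal_ofReal
    hb0.aemeasurable.ennreal_ofReal] at hμ
  filter_upwards [hμ] with x hx
  exact (ENNReal.ofReal_eq_ofReal_iff (ha_nn x) (hb_nn x)).1 hx

lemma exp_mul_expWeight (l s : ℝ) (a : ℝ → ℝ) (x : ℝ) :
    Real.exp (s * x) * expWeight l a x = expWeight (l - s) a x := by
  rcases lt_or_ge 0 x with hx | hx
  · rw [expWeight_of_pos _ hx, expWeight_of_pos _ hx, ← mul_assoc, ← Real.exp_add]
    ring_nf
  · simp [expWeight_of_nonpos _ hx]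

/-- The exponential of `x` factors over `r` and `x - r`. Hence evaluating the two-sided transform at
`s` amounts to replacing the weight `l` by `l - s`, which stays positive for `s < l`. -/
lemma exp_mul_conv_expWeight (l s : ℝ) (a b : ℝ → ℝ) (x : ℝ) :
    Real.exp (s * x) * conv (expWeight l a) (expWeight l b) x
      = conv (expWeight (l - s) a) (expWeight (l - s) b) x := by
  rw [conv, ← integral_const_mul]
  refine integral_congr_ae (Eventually.of_forall fun r => ?_)
  simp only [← exp_mul_expWeight, smul_eq_mul]
  rw [mul_sub, Real.exp_sub]
  field_simp

lemma integrable_conv_of_integrable {a b : ℝ → ℝ} (ha : Integrable a) (hb : Integrable b) :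
    Integrable (conv a b) :=
  ha.integrable_convolution (ContinuousLinearMap.mul ℝ ℝ) hb

lemma integral_conv {a b : ℝ → ℝ} (ha : Integrable a) (hb : Integrable b) :
    ∫ x, conv a b x = (∫ x, a x) * ∫ x, b x :=
  integral_convolution (ContinuousLinearMap.mul ℝ ℝ) ha hb

lemma integral_expWeight (l : ℝ) (a : ℝ → ℝ) :
    ∫ x, expWeight l a x = ∫ x in Ioi 0, Real.exp (-(l * x)) * a x :=
  integral_indicator measurableSet_Ioi

lemma integrable_expWeight_iff {l : ℝ} {a : ℝ → ℝ} :
    Integrable (expWeight l a) ↔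
      IntegrableOn (fun x => Real.exp (-(l * x)) * a x) (Ioi 0) :=
  integrable_indicator_iff measurableSet_Ioi

lemma integrable_expWeight_one {l : ℝ} (hl : 0 < l) : Integrable (expWeight l fun _ => 1) := by
  rw [integrable_expWeight_iff]
  simpa [neg_mul] using integrableOn_exp_mul_Ioi (neg_neg_of_pos hl) 0

lemma integral_expWeight_one {l : ℝ} (hl : 0 < l) :
    ∫ x, expWeight l (fun _ => 1) x = 1 / l := by
  rw [integral_expWeight]
  have h := integral_exp_mul_Ioi (neg_neg_of_pos hl) 0
  simpa [neg_mul] using h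

/-- If the Laplace transforms of `a` and `b` multiply to `1 / l`, then `a` and `b` satisfy the
Sonine relation `a * b = 1`. -/
lemma conv_expWeight_ae_eq_one {a b : ℝ → ℝ} (ha_nn : ∀ x, 0 < x → 0 ≤ a x)
    (hb_nn : ∀ x, 0 < x → 0 ≤ b x)
    (ha : ∀ l, 0 < l → Integrable (expWeight l a)) (hb : ∀ l, 0 < l → Integrable (expWeight l b))
    (hab : ∀ l, 0 < l → (∫ x, expWeight l a x) * ∫ x, expWeight l b x = 1 / l)
    {l : ℝ} (hl : 0 < l) :
    conv (expWeight l a) (expWeight l b) =ᵐ[volume] expWeight l fun _ => 1 := by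
  refine ae_eq_of_integral_exp_mul_eq hl
    (fun x => integral_nonneg fun r =>
      mul_nonneg (expWeight_nonneg ha_nn r) (expWeight_nonneg hb_nn _))
    (expWeight_nonneg fun _ _ => zero_le_one) ?_ ?_ ?_
  · intro s hs
    simp only [exp_mul_conv_expWeight]
    exact integrable_conv_of_integrable (ha _ (by linarith [hs.2])) (hb _ (by linarith [hs.2]))
  · intro s hs
    simp only [exp_mul_expWeight]
    exact integrable_expWeight_one (by linarith [hs.2])
  · intro s hs
    have hls : 0 < l - s := by linarith [hs.2]
    simp only [exp_mul_conv_expWeight, exp_mul_expWeight]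
    rw [integral_conv (ha _ hls) (hb _ hls), hab _ hls, integral_expWeight_one hls]

/-- Integrals of exponentially weighted kernels from lower Lebesgue integrals. -/
lemma expWeight_of_lintegral {l c : ℝ} {a : ℝ → ℝ} (hc : 0 ≤ c)
    (ha : AEMeasurable a (volume.restrict (Ioi 0))) (ha_nn : ∀ x, 0 < x → 0 ≤ a x)
    (h : ∫⁻ x in Ioi 0, ENNReal.ofReal (a x) * ENNReal.ofReal (Real.exp (-(l * x)))
      = ENNReal.ofReal c) :
    Integrable (expWeight l a) ∧ ∫ x, expWeight l a x = c := by
  have hm : AEStronglyMeasurable (fun x => Real.exp (-(l * x)) * a x)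
      (volume.restrict (Ioi 0)) := by
    refine AEMeasurable.aestronglyMeasurable (AEMeasurable.mul ?_ ha)
    fun_prop
  have hnn : 0 ≤ᵐ[volume.restrict (Ioi 0)] fun x => Real.exp (-(l * x)) * a x := by
    filter_upwards [ae_restrict_mem measurableSet_Ioi] with x hx
    exact mul_nonneg (Real.exp_pos _).le (ha_nn x hx)
  have hl : ∫⁻ x in Ioi 0, ENNReal.ofReal (Real.exp (-(l * x)) * a x) = ENNReal.ofReal c := by
    rw [← h]
    refine lintegral_congr fun x => ?_
    rw [ENNReal.ofReal_mul (Real.exp_pos _).le, mul_comm]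
  constructor
  · rw [integrable_expWeight_iff]
    refine ⟨hm, (hasFiniteIntegral_iff_ofReal hnn).2 ?_⟩
    rw [hl]
    exact ENNReal.ofReal_lt_top
  · rw [integral_expWeight, integral_eq_lintegral_of_nonneg_ae hnn hm, hl,
      ENNReal.toReal_ofReal hc]

lemma lintegral_exp_neg_mul {l : ℝ} (hl : 0 < l) :
    ∫⁻ x in Ioi (0 : ℝ), ENNReal.ofReal (Real.exp (-(l * x))) = ENNReal.ofReal (1 / l) := by
  have h1 := integrable_expWeight_iff.1 (integrable_expWeight_one hl)
  have h2 := integral_expWeight_one hl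
  simp only [mul_one] at h1
  simp only [integral_expWeight, mul_one] at h2
  rw [← h2, ofReal_integral_eq_lintegral_ofReal h1
    (Eventually.of_forall fun x => (Real.exp_pos _).le)]

end Laplace

/-! ### Laplace transform of the potential density -/

section Potential

variable {Ω : Type*} [MeasurableSpace Ω] {P : Measure Ω} [IsProbabilityMeasure P]
  {σ : ℝ≥0 → Ω → ℝ} {Φ : ℝ → ℝ}

/-- A process with right-continuous paths is jointly measurable up to null sets. -/
lemma IsSubordinator.aemeasurable_prod {P : Measure Ω} (hσ : IsSubordinator P σ) :
    AEMeasurable (fun p : Ω × ℝ => σ p.2.toNNReal p.1)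
      (P.prod ((volume : Measure ℝ).restrict (Ici 0))) := by
  -- Discretised times with `x ≤ τ n x ≤ x + 1/(n+1)` for `x ≥ 0`: the `+ 1` in the numerator makes
  -- the approximation come from the right, as right-continuity requires. Each `τ n` has countable
  -- range, so the sampled process is jointly measurable.
  let τ : ℕ → ℝ → ℝ≥0 := fun n x => ((⌊x * ((n : ℝ) + 1)⌋₊ : ℝ≥0) + 1) / ((n : ℝ≥0) + 1)
  have hτ : ∀ n, Measurable fun p : Ω × ℝ => σ (τ n p.2) p.1 := by
    intro n
    have h1 : ∀ (ρ : ℕ → ℝ≥0) {g : ℝ → ℕ}, Measurable g →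
        Measurable fun p : Ω × ℝ => σ (ρ (g p.2)) p.1 := by
      intro ρ g hg
      have h2 : Measurable fun q : Ω × ℕ => σ (ρ q.2) q.1 :=
        measurable_from_prod_countable_left fun m => hσ.measurable (ρ m)
      exact h2.comp (measurable_fst.prodMk (hg.comp measurable_snd))
    exact h1 (fun m => ((m : ℝ≥0) + 1) / ((n : ℝ≥0) + 1))
      (g := fun x => ⌊x * ((n : ℝ) + 1)⌋₊) (Nat.measurable_floor.comp (measurable_id.mul_const _))
  refine aemeasurable_of_tendsto_metrizable_ae atTop (fun n => (hτ n).aemeasurable) ?_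
  have h1 : ∀ᵐ p ∂(P.prod ((volume : Measure ℝ).restrict (Ici 0))),
      ∀ t, ContinuousWithinAt (fun s => σ s p.1) (Ici t) t :=
    Measure.quasiMeasurePreserving_fst.ae hσ.rightCont
  have h2 : ∀ᵐ p ∂(P.prod ((volume : Measure ℝ).restrict (Ici 0))), p.2 ∈ Ici (0 : ℝ) :=
    Measure.quasiMeasurePreserving_snd.ae (ae_restrict_mem measurableSet_Ici)
  filter_upwards [h1, h2] with p hp hp2
  have hp2' : 0 ≤ p.2 := hp2
  have hlow : ∀ n, p.2 ≤ (τ n p.2 : ℝ) := by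
    intro n
    simp only [τ, NNReal.coe_div, NNReal.coe_add, NNReal.coe_natCast, NNReal.coe_one]
    rw [le_div_iff₀ (by positivity)]
    exact (Nat.lt_floor_add_one _).le
  have hup : ∀ n : ℕ, (τ n p.2 : ℝ) ≤ p.2 + 1 / ((n : ℝ) + 1) := by
    intro n
    simp only [τ, NNReal.coe_div, NNReal.coe_add, NNReal.coe_natCast, NNReal.coe_one]
    rw [div_le_iff₀ (by positivity), add_mul, one_div_mul_cancel (by positivity)]
    have : (⌊p.2 * ((n : ℝ) + 1)⌋₊ : ℝ) ≤ p.2 * ((n : ℝ) + 1) := Nat.floor_le (by positivity)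
    linarith
  have hlim : Tendsto (fun n => τ n p.2) atTop (𝓝 p.2.toNNReal) := by
    rw [← NNReal.tendsto_coe, Real.coe_toNNReal _ hp2']
    refine tendsto_of_tendsto_of_tendsto_of_le_of_le tendsto_const_nhds ?_ hlow hup
    simpa using tendsto_const_nhds.add (tendsto_one_div_add_atTop_nhds_zero_nat (𝕜 := ℝ))
  refine (hp p.2.toNNReal).tendsto.comp (tendsto_nhdsWithin_iff.2 ⟨hlim, ?_⟩)
  refine Eventually.of_forall fun n => ?_
  rw [mem_Ici, Real.toNNReal_le_iff_le_coe]
  exact hlow n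

/-- By Tonelli the left side is the integral of `exp(-s Φ(l))` over `s > 0`. -/
lemma lintegral_exp_potentialMeasure (hσ : IsSubordinator P σ) (hσΦ : HasLaplaceExponent P σ Φ)
    {l : ℝ} (hl : 0 < l) (hΦ : 0 < Φ l) :
    ∫⁻ x, ENNReal.ofReal (Real.exp (-(l * x))) ∂(potentialMeasure P σ)
      = ENNReal.ofReal (1 / Φ l) := by
  have hm := hσ.aemeasurable_prod
  have he : Measurable fun x : ℝ => ENNReal.ofReal (Real.exp (-(l * x))) := by fun_prop
  rw [potentialMeasure, lintegral_map' he.aemeasurable hm,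
    lintegral_prod_symm (fun p : Ω × ℝ => ENNReal.ofReal (Real.exp (-(l * σ p.2.toNNReal p.1))))
      (he.comp_aemeasurable hm), ← lintegral_exp_neg_mul hΦ,
    ← restrict_Ioi_eq_restrict_Ici]
  refine setLIntegral_congr_fun measurableSet_Ioi fun s hs => ?_
  have h := hσΦ s.toNNReal l hl
  rw [Real.coe_toNNReal _ (le_of_lt hs)] at h
  have hint : Integrable (fun ω => Real.exp (-(l * σ s.toNNReal ω))) P := by
    -- A non-integrable function would have integral `0` by convention, whereas the Laplace exponent
    -- gives a positive value.
    by_contra hcon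
    rw [integral_undef hcon] at h
    exact (Real.exp_pos _).ne h
  simp only
  rw [← ofReal_integral_eq_lintegral_ofReal hint
    (Eventually.of_forall fun _ => (Real.exp_pos _).le), h, mul_comm]

lemma IsPotentialDensity.expWeight (hσ : IsSubordinator P σ) (hσΦ : HasLaplaceExponent P σ Φ)
    {u : ℝ → ℝ} (hu : IsPotentialDensity (potentialMeasure P σ) u)
    {l : ℝ} (hl : 0 < l) (hΦ : 0 < Φ l) :
    Integrable (expWeight l u) ∧ ∫ x, expWeight l u x = 1 / Φ l := by
  have hum : AEMeasurable u (volume.restrict (Ioi 0)) :=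
    aemeasurable_restrict_of_antitoneOn measurableSet_Ioi hu.antitone
  refine expWeight_of_lintegral (by positivity) hum hu.nonneg ?_
  rw [← lintegral_exp_potentialMeasure hσ hσΦ hl hΦ, hu.density,
    lintegral_withDensity_eq_lintegral_mul₀ hum.ennreal_ofReal (by fun_prop)]
  rfl

end Potential

/-! ### Laplace transform of the tail of the Lévy measure -/

section Tail

variable {Φ : ℝ → ℝ} {ν : Measure ℝ}

/-- Markov's inequality for `min 1 x`, which is at least `min 1 t` on `(t,∞)`. -/
lemma IsLevyTriplet.measure_Ioi_lt_top {a b : ℝ} (hν : IsLevyTriplet Φ a b ν) {t : ℝ}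
    (ht : 0 < t) : ν (Ioi t) < ⊤ := by
  have h1 : ENNReal.ofReal (min 1 t) * ν (Ioi t) < ⊤ := by
    refine lt_of_le_of_lt ?_ hν.integrability
    rw [← setLIntegral_const]
    refine (setLIntegral_mono' measurableSet_Ioi fun x hx => ?_).trans
      (lintegral_mono_set (Ioi_subset_Ioi ht.le))
    exact ENNReal.ofReal_le_ofReal (min_le_min_left _ (le_of_lt hx))
  have h2 : ENNReal.ofReal (min 1 t) ≠ 0 := by simpa using ht
  exact (ENNReal.lt_top_of_mul_ne_top_right h1.ne h2)

lemma tail_nonneg (t : ℝ) : 0 ≤ tail ν t := ENNReal.toReal_nonneg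

lemma IsLevyTriplet.antitoneOn_tail {a b : ℝ} (hν : IsLevyTriplet Φ a b ν) :
    AntitoneOn (tail ν) (Ioi 0) := fun _ hs _ _ hst =>
  ENNReal.toReal_mono (hν.measure_Ioi_lt_top hs).ne (measure_mono (Ioi_subset_Ioi hst))

lemma one_sub_exp_neg_le {l x : ℝ} (hx : 0 < x) :
    1 - Real.exp (-(l * x)) ≤ max 1 l * min 1 x := by
  have h1 := Real.add_one_le_exp (-(l * x))
  have h2 := Real.exp_pos (-(l * x))
  rcases le_total 1 x with h | h
  · rw [min_eq_left h]
    linarith [le_max_left 1 l]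
  · rw [min_eq_right h]
    have := mul_le_mul_of_nonneg_right (le_max_right 1 l) hx.le
    linarith

/-- Layer cake formula: `(1 - exp(-l x))/l` is the integral of `exp(-l t)` over `t` in `[0,x]`;
integrating in `ν` and exchanging the order produces `ν(t,∞)`. -/
lemma IsLevyTriplet.expWeight_tail (hν : IsLevyTriplet Φ 0 0 ν) {l : ℝ} (hl : 0 < l) :
    Integrable (expWeight l (tail ν)) ∧ ∫ x, expWeight l (tail ν) x = Φ l / l := by
  have hnn : ∀ x : ℝ, 0 < x → 0 ≤ 1 - Real.exp (-(l * x)) := fun x hx => by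
    have : Real.exp (-(l * x)) ≤ 1 := Real.exp_le_one_iff.2 (by nlinarith)
    linarith
  have hnn' : 0 ≤ᵐ[ν.restrict (Ioi 0)] fun x => 1 - Real.exp (-(l * x)) := by
    filter_upwards [ae_restrict_mem measurableSet_Ioi] with x hx
    exact hnn x hx
  have hint : Integrable (fun x => 1 - Real.exp (-(l * x))) (ν.restrict (Ioi 0)) := by
    refine ⟨by fun_prop, (hasFiniteIntegral_iff_ofReal hnn').2 ?_⟩
    have h3 : ∫⁻ x in Ioi (0 : ℝ), ENNReal.ofReal (max 1 l) * ENNReal.ofReal (min 1 x) ∂ν < ⊤ := by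
      rw [lintegral_const_mul' _ _ ENNReal.ofReal_ne_top]
      exact ENNReal.mul_lt_top ENNReal.ofReal_lt_top hν.integrability
    refine lt_of_le_of_lt (setLIntegral_mono' measurableSet_Ioi fun x hx => ?_) h3
    rw [← ENNReal.ofReal_mul (by positivity)]
    exact ENNReal.ofReal_le_ofReal (one_sub_exp_neg_le hx)
  have hΦ : Φ l = ∫ x in Ioi (0 : ℝ), (1 - Real.exp (-(l * x))) ∂ν := by
    rw [hν.repr l hl]
    ring
  have hΦ0 : 0 ≤ Φ l := by
    rw [hΦ]
    exact integral_nonneg_of_ae hnn'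
  refine expWeight_of_lintegral (by positivity)
    (aemeasurable_restrict_of_antitoneOn measurableSet_Ioi hν.antitoneOn_tail)
    (fun x _ => tail_nonneg x) ?_
  have hprim : ∀ x : ℝ, ∫ t in (0 : ℝ)..x, Real.exp (-(l * t))
      = (1 - Real.exp (-(l * x))) * l⁻¹ := by
    intro x
    have hd : ∀ t ∈ uIcc 0 x, HasDerivAt (fun t => -Real.exp (-(l * t)) * l⁻¹)
        (Real.exp (-(l * t))) t := by
      intro t _
      have h5 : HasDerivAt (fun t : ℝ => -(l * t)) (-(l * 1)) t :=
        ((hasDerivAt_id t).const_mul l).neg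
      convert! (h5.exp.neg.mul_const l⁻¹) using 1
      field_simp
    rw [intervalIntegral.integral_eq_sub_of_hasDerivAt hd
      (by apply Continuous.intervalIntegrable; fun_prop)]
    simp
    ring
  have hcake := lintegral_comp_eq_lintegral_meas_lt_mul (ν.restrict (Ioi 0)) (f := id)
    (g := fun t => Real.exp (-(l * t)))
    (by filter_upwards [ae_restrict_mem measurableSet_Ioi] with x hx using le_of_lt hx)
    aemeasurable_id (fun t _ => by apply Continuous.intervalIntegrable; fun_prop)
    (Eventually.of_forall fun t => (Real.exp_pos _).le)
  simp only [id, hprim] at hcake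
  have hleft : ∫⁻ x in Ioi (0 : ℝ), ENNReal.ofReal ((1 - Real.exp (-(l * x))) * l⁻¹) ∂ν
      = ENNReal.ofReal (Φ l / l) := by
    rw [div_eq_mul_inv, hΦ, ← integral_mul_const, ofReal_integral_eq_lintegral_ofReal
      (hint.mul_const _)]
    filter_upwards [hnn'] with x hx
    exact mul_nonneg hx (inv_nonneg.2 hl.le)
  rw [← hleft, hcake]
  refine setLIntegral_congr_fun measurableSet_Ioi fun t ht => ?_
  have hset : ν.restrict (Ioi 0) {a | t < a} = ν (Ioi t) := by
    change ν.restrict (Ioi 0) (Ioi t) = _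
    rw [Measure.restrict_apply measurableSet_Ioi]
    congr 1
    exact inter_eq_left.2 (Ioi_subset_Ioi (le_of_lt ht))
  simp only [hset, tail, ENNReal.ofReal_toReal (hν.measure_Ioi_lt_top ht).ne]

end Tail

/-! ### Vanishing of the weighted mass for large weights -/

section Decay

/-- The exponentially weighted mass of an integrable kernel tends to `0`. -/
lemma tendsto_integral_expWeight {a : ℝ → ℝ} (ha_nn : ∀ r, 0 < r → 0 ≤ a r)
    (ha : ∀ l, 0 < l → Integrable (expWeight l a)) :
    Tendsto (fun l => ∫ x, expWeight l a x) atTop (𝓝 0) := by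
  have h0 : ∫ _ : ℝ, (0 : ℝ) = 0 := by simp
  rw [← h0]
  -- The weight `l = 1` dominates all weights `l ≥ 1`.
  refine tendsto_integral_filter_of_dominated_convergence (expWeight 1 a) ?_ ?_
    (ha 1 one_pos) (Eventually.of_forall fun x => ?_)
  · filter_upwards [eventually_gt_atTop 0] with l hl using (ha l hl).aestronglyMeasurable
  · filter_upwards [eventually_ge_atTop 1] with l hl
    refine Eventually.of_forall fun x => ?_
    rw [Real.norm_of_nonneg (expWeight_nonneg ha_nn x)]
    rcases lt_or_ge 0 x with hx | hx
    · rw [expWeight_of_pos _ hx, expWeight_of_pos _ hx]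
      refine mul_le_mul_of_nonneg_right (Real.exp_le_exp.2 ?_) (ha_nn x hx)
      nlinarith
    · simp [expWeight_of_nonpos _ hx]
  · rcases lt_or_ge 0 x with hx | hx
    · simp only [expWeight_of_pos _ hx]
      have h1 : Tendsto (fun l : ℝ => Real.exp (-(l * x))) atTop (𝓝 0) :=
        Real.tendsto_exp_neg_atTop_nhds_zero.comp (tendsto_id.atTop_mul_const hx)
      simpa using h1.mul_const (a x)
    · simp [expWeight_of_nonpos _ hx]

end Decay

/-- A pair of nonnegative kernels on `(0,∞)` with `u * k = 1`, the kernel `u` being nonincreasing,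
in terms of their exponentially weighted versions. -/
structure IsSoninePair (u k : ℝ → ℝ) : Prop where
  nonneg : ∀ r, 0 < r → 0 ≤ u r
  antitone : AntitoneOn u (Ioi 0)
  integrable_left : ∀ l, 0 < l → Integrable (expWeight l u)
  integrable_right : ∀ l, 0 < l → Integrable (expWeight l k)
  conv_eq : ∀ l, 0 < l →
    conv (expWeight l u) (expWeight l k) =ᵐ[volume] expWeight l fun _ => 1

lemma conv_comm (a b : ℝ → ℝ) : conv a b = conv b a := by
  ext t
  rw [conv, ← integral_sub_left_eq_self _ volume t]
  simp only [sub_sub_cancel, smul_eq_mul, mul_comm, conv]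

lemma antitoneOn_expWeight {l : ℝ} (hl : 0 ≤ l) {u : ℝ → ℝ} (hu : ∀ r, 0 < r → 0 ≤ u r)
    (hanti : AntitoneOn u (Ioi 0)) : AntitoneOn (expWeight l u) (Ioi 0) := by
  intro r hr s hs hrs
  rw [expWeight_of_pos _ hr, expWeight_of_pos _ hs]
  refine mul_le_mul (Real.exp_le_exp.2 ?_) (hanti hr hs hrs) (hu s hs) (Real.exp_pos _).le
  nlinarith

/-! ### Passage between weighted convolutions on the line and integrals over `[0,t]` -/

section Transfer

variable {X : Type*} [NormedAddCommGroup X] [NormedSpace ℝ X]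

lemma expWeight_smul_eq_indicator (k : ℝ → ℝ) {l t : ℝ} {z w : ℝ → X}
    (hw0 : ∀ x ≤ 0, w x = 0) (hw : ∀ x, 0 < x → x ≤ t → w x = Real.exp (-(l * x)) • z x) :
    (fun s => expWeight l k (t - s) • w s)
      = (Ioo 0 t).indicator fun s => Real.exp (-(l * t)) • (k (t - s) • z s) := by
  ext s
  by_cases hs : s ∈ Ioo 0 t
  · rw [indicator_of_mem hs, hw s hs.1 hs.2.le, expWeight_of_pos _ (by linarith [hs.2]), smul_smul,
      smul_smul, mul_right_comm, ← Real.exp_add]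
    ring_nf
  · rw [indicator_of_notMem hs]
    rcases le_or_gt s 0 with h | h
    · rw [hw0 s h, smul_zero]
    · rw [expWeight_of_nonpos _ (by by_contra h'; exact hs ⟨h, by linarith⟩), zero_smul]

/-- The kernel vanishes for `s ≥ t` and `w` for `s ≤ 0`, so only `(0,t)` contributes, and there the
weights of the two factors multiply to the constant `exp(-l t)`. -/
lemma conv_expWeight_eq (k : ℝ → ℝ) {l t : ℝ} (ht : 0 ≤ t) {z w : ℝ → X}
    (hw0 : ∀ x ≤ 0, w x = 0) (hw : ∀ x, 0 < x → x ≤ t → w x = Real.exp (-(l * x)) • z x) :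
    conv (expWeight l k) w t = Real.exp (-(l * t)) • ∫ s in (0 : ℝ)..t, k (t - s) • z s := by
  rw [conv, ← integral_sub_left_eq_self _ volume t]
  simp only [sub_sub_cancel]
  rw [expWeight_smul_eq_indicator k hw0 hw, integral_indicator measurableSet_Ioo,
    integral_smul, intervalIntegral.integral_of_le ht, integral_Ioc_eq_integral_Ioo]

lemma intervalIntegrable_of_expWeight {k : ℝ → ℝ} {l t M : ℝ} (ht : 0 ≤ t)
    (hk : Integrable (expWeight l k)) {z w : ℝ → X}
    (hw0 : ∀ x ≤ 0, w x = 0) (hw : ∀ x, 0 < x → x ≤ t → w x = Real.exp (-(l * x)) • z x)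
    (hwm : AEStronglyMeasurable w) (hM : ∀ x, ‖w x‖ ≤ M) :
    IntervalIntegrable (fun s => k (t - s) • z s) volume 0 t := by
  have h := (integrable_conv hk hwm hM t).comp_sub_left t
  simp only [sub_sub_cancel] at h
  rw [expWeight_smul_eq_indicator k hw0 hw, integrable_indicator_iff measurableSet_Ioo] at h
  rw [intervalIntegrable_iff_integrableOn_Ioo_of_le ht]
  exact (integrable_smul_iff (Real.exp_pos _).ne' _).1 h

/-- A continuous function whose integrals over all `[0,t]`, `t ≤ T`, vanish is zero there. -/
lemma eq_zero_of_integral_eq_zero [CompleteSpace X] {q : ℝ → X} (hq : Continuous q) {T : ℝ}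
    (h : ∀ t, 0 ≤ t → t ≤ T → ∫ s in (0 : ℝ)..t, q s = 0) {t : ℝ} (ht0 : 0 < t) (htT : t ≤ T) :
    q t = 0 := by
  -- Left derivatives are compared, so that the endpoint `t = T` is included.
  have h1 : HasDerivWithinAt (fun x => ∫ s in (0 : ℝ)..x, q s) (q t) (Iic t) t :=
    (hq.integral_hasStrictDerivAt 0 t).hasDerivAt.hasDerivWithinAt
  have h2 : HasDerivWithinAt (fun x => ∫ s in (0 : ℝ)..x, q s) 0 (Iic t) t := by
    refine (hasDerivWithinAt_const t (Iic t) (0 : X)).congr_of_eventuallyEq ?_ (h t ht0.le htT)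
    filter_upwards [self_mem_nhdsWithin, mem_nhdsWithin_of_mem_nhds (Ioi_mem_nhds ht0)] with x hx hx0
    exact h x (le_of_lt hx0) (le_trans hx htT)
  exact (uniqueDiffOn_Iic t t (mem_Iic.2 le_rfl)).eq_deriv _ h1 h2

lemma continuousAt_expWeight_one (l : ℝ) {x : ℝ} (hx : x ≠ 0) :
    ContinuousAt (expWeight l fun _ => 1) x := by
  rcases lt_or_gt_of_ne hx with h | h
  · refine (continuousAt_const (y := (0 : ℝ))).congr ?_
    filter_upwards [Iio_mem_nhds h] with y hy
    exact (expWeight_of_nonpos _ (le_of_lt hy)).symm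
  · have hc : ContinuousAt (fun r : ℝ => Real.exp (-(l * r)) * 1) x := by fun_prop
    refine hc.congr ?_
    filter_upwards [Ioi_mem_nhds h] with y hy
    exact (expWeight_of_pos (fun _ => 1) hy).symm

lemma expWeight_one_le {l : ℝ} (hl : 0 ≤ l) (x : ℝ) : ‖expWeight l (fun _ => 1) x‖ ≤ 1 := by
  rw [Real.norm_of_nonneg (expWeight_nonneg (fun _ _ => zero_le_one) x)]
  rcases lt_or_ge 0 x with hx | hx
  · rw [expWeight_of_pos _ hx, mul_one]
    exact Real.exp_le_one_iff.2 (by nlinarith)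
  · rw [expWeight_of_nonpos _ hx]
    exact zero_le_one

end Transfer

/-! ### Uniqueness, Hölder regularity and existence for a Sonine pair -/

namespace IsSoninePair

variable {X : Type*} [NormedAddCommGroup X] [NormedSpace ℝ X] {u k : ℝ → ℝ}

lemma exists_weight (h : IsSoninePair u k) (F : X →L[ℝ] X) :
    ∃ l, 0 < l ∧ ‖F‖ * ∫ x, expWeight l u x < 1 := by
  have h1 : Tendsto (fun l => ‖F‖ * ∫ x, expWeight l u x) atTop (𝓝 (‖F‖ * 0)) :=
    (tendsto_integral_expWeight h.nonneg h.integrable_left).const_mul _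
  rw [mul_zero] at h1
  exact ((eventually_gt_atTop 0).and (h1.eventually (gt_mem_nhds one_pos))).exists

/-- A continuous solution on `[0,T]` of the homogeneous equation with zero initial value
vanishes. -/
lemma eq_zero_of_integral_eq [CompleteSpace X] (h : IsSoninePair u k) (F : X →L[ℝ] X) {T : ℝ}
    {z : ℝ → X} (hz : Continuous z) (hz0 : ∀ x ≤ 0, z x = 0) {N : ℝ} (hN : ∀ x, ‖z x‖ ≤ N)
    (heq : ∀ t, 0 ≤ t → t ≤ T →
      ∫ s in (0 : ℝ)..t, k (t - s) • z s = ∫ s in (0 : ℝ)..t, F (z s)) :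
    ∀ t ≤ T, z t = 0 := by
  obtain ⟨l, hl, hlF⟩ := h.exists_weight F
  have hu := h.integrable_left l hl
  have hk := h.integrable_right l hl
  have h1 := integrable_expWeight_one hl
  have hu_nn := expWeight_nonneg (l := l) h.nonneg
  have hu0 : ∀ r < 0, expWeight l u r = 0 := fun r hr => expWeight_of_nonpos _ hr.le
  have h10 : ∀ r < 0, expWeight l (fun _ => 1) r = 0 := fun r hr => expWeight_of_nonpos _ hr.le
  set w : ℝ → X := fun x => Real.exp (-(l * x)) • z x with hw
  have hwc : Continuous w := by fun_prop
  have hw0 : ∀ x ≤ 0, w x = 0 := fun x hx => by simp [hw, hz0 x hx]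
  have hwN : ∀ x, ‖w x‖ ≤ N := by
    intro x
    rcases le_or_gt x 0 with hx | hx
    · rw [hw0 x hx, norm_zero]
      exact (norm_nonneg _).trans (hN 0)
    · rw [hw, norm_smul, Real.norm_of_nonneg (Real.exp_pos _).le]
      exact (mul_le_of_le_one_left (norm_nonneg _) (Real.exp_le_one_iff.2 (by nlinarith))).trans
        (hN x)
  have hFc : Continuous fun x => F (w x) := by fun_prop
  have hFN : ∀ x, ‖F (w x)‖ ≤ ‖F‖ * N := fun x =>
    (F.le_opNorm _).trans (mul_le_mul_of_nonneg_left (hwN x) (norm_nonneg _))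
  have hF0 : ∀ x ≤ 0, F (w x) = 0 := fun x hx => by rw [hw0 x hx, map_zero]
  have hwm := hwc.aestronglyMeasurable (μ := volume)
  have hFm := hFc.aestronglyMeasurable (μ := volume)
  have hconv0 : ∀ (a : ℝ → ℝ) (f : ℝ → X) (t : ℝ), t ≤ 0 → (∀ r < 0, a r = 0) →
      (∀ x ≤ 0, f x = 0) → conv a f t = 0 := by
    intro a f t ht ha hf
    rw [conv_congr_Iic (g := fun _ => 0) ha fun x hx => hf x (hx.trans ht)]
    simp [conv]
  have hkw : ∀ t ≤ T, conv (expWeight l k) w t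
      = conv (expWeight l fun _ => 1) (fun x => F (w x)) t := by
    intro t ht
    rcases le_or_gt t 0 with ht0 | ht0
    · rw [hconv0 _ _ t ht0 (fun r hr => expWeight_of_nonpos _ hr.le) hw0,
        hconv0 _ _ t ht0 h10 hF0]
    · rw [conv_expWeight_eq k ht0.le hw0 (fun x _ _ => rfl), heq t ht0.le ht,
        conv_expWeight_eq (fun _ => 1) ht0.le hF0 (z := fun x => F (z x))
          (fun x _ _ => by simp [hw])]
      simp
  set y : ℝ → X := conv (expWeight l u) fun x => F (w x) with hy
  have hyc : Continuous y := continuous_conv (s := 0) hu hFm hFN fun x _ => hFc.continuousAt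
  have hyN : ∀ x, ‖y x‖ ≤ (∫ x, expWeight l u x) * (‖F‖ * N) := fun x =>
    norm_conv_le hu hu_nn hu0 fun x _ => hFN x
  have hy0 : ∀ x ≤ 0, y x = 0 := fun x hx => hconv0 _ _ x hx hu0 hF0
  -- Convolving `k * w = 1 * F w` with `u` and using `u * k = 1` gives `1 * w = 1 * (u * F w) = 1 *
  -- y`, all kernels being weighted.
  have hmain : ∀ t ≤ T, conv (expWeight l fun _ => 1) (fun x => w x - y x) t = 0 := by
    intro t ht
    rw [conv_sub h1 hwm hwN hyc.aestronglyMeasurable hyN, sub_eq_zero,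
      ← conv_congr_left (h.conv_eq l hl) w, ← conv_assoc hu hk hwm hwN,
      conv_congr_Iic hu0 fun x hx => hkw x (hx.trans ht), conv_assoc hu h1 hFm hFN, conv_comm,
      ← conv_assoc h1 hu hFm hFN]
  have hwy : ∀ t ≤ T, w t = y t := by
    intro t ht
    rcases le_or_gt t 0 with ht0 | ht0
    · rw [hw0 t ht0, hy0 t ht0]
    · have hq : Continuous fun x => Real.exp (l * x) • (w x - y x) := by fun_prop
      have h2 := eq_zero_of_integral_eq_zero hq (T := T) (fun t ht0 ht => ?_) ht0 ht
      · exact sub_eq_zero.1 ((smul_eq_zero.1 h2).resolve_left (Real.exp_pos _).ne')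
      · have h3 := hmain t ht
        rw [conv_expWeight_eq (z := fun x => Real.exp (l * x) • (w x - y x)) (fun _ => 1) ht0
          (fun x hx => by rw [hw0 x hx, hy0 x hx, sub_zero])
          (fun x _ _ => by rw [smul_smul, ← Real.exp_add]; simp)] at h3
        simpa using h3
  intro t ht
  have h4 := eq_zero_of_eq_conv hu hu_nn hu0 F hlF (fun x _ => hwN x) hwy t ht
  exact (smul_eq_zero.1 h4).resolve_left (Real.exp_pos _).ne'

lemma integral_expWeight_le (h : IsSoninePair u k) {l t₀ C β : ℝ} (hl : 0 < l) (hβ : 0 < β)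
    (hu_le : ∀ t ∈ Ioo 0 t₀, u t ≤ C * t ^ (β - 1)) {d : ℝ} (hd0 : 0 ≤ d) (hd : d < t₀) :
    ∫ r in (0 : ℝ)..d, expWeight l u r ≤ C / β * d ^ β := by
  have h1 : ∫ r in (0 : ℝ)..d, C * r ^ (β - 1) = C / β * d ^ β := by
    rw [intervalIntegral.integral_const_mul, integral_rpow (Or.inl (by linarith)), sub_add_cancel,
      Real.zero_rpow hβ.ne']
    ring
  rw [← h1]
  refine intervalIntegral.integral_mono_on_of_le_Ioo hd0
    (h.integrable_left l hl).intervalIntegrable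
    ((intervalIntegral.intervalIntegrable_rpow' (by linarith)).const_mul C) fun r hr => ?_
  rw [expWeight_of_pos _ hr.1]
  refine (mul_le_of_le_one_left (h.nonneg r hr.1) (Real.exp_le_one_iff.2 ?_)).trans
    (hu_le r ⟨hr.1, hr.2.trans hd⟩)
  nlinarith [hr.1]

/-- Convolution with a kernel that is bounded by `C t ^ (β - 1)` near `0` maps bounded functions
to Hölder continuous ones. -/
lemma norm_conv_sub_le_rpow (h : IsSoninePair u k) {l t₀ C β : ℝ} (hl : 0 < l) (ht₀ : 0 < t₀)
    (hC : 0 < C) (hβ : 0 < β) (hu_le : ∀ t ∈ Ioo 0 t₀, u t ≤ C * t ^ (β - 1)) {f : ℝ → X} {M : ℝ}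
    (hf : AEStronglyMeasurable f) (hM : ∀ x, ‖f x‖ ≤ M) :
    ∃ L, ∀ s t, ‖conv (expWeight l u) f t - conv (expWeight l u) f s‖ ≤ L * |t - s| ^ β := by
  have hM0 : 0 ≤ M := (norm_nonneg _).trans (hM 0)
  set N := (∫ r, expWeight l u r) * M with hN
  have hN0 : 0 ≤ N := mul_nonneg (integral_nonneg (expWeight_nonneg h.nonneg)) hM0
  have hNle : ∀ x, ‖conv (expWeight l u) f x‖ ≤ N := fun x =>
    norm_conv_le (h.integrable_left l hl) (expWeight_nonneg h.nonneg)
      (fun r hr => expWeight_of_nonpos _ hr.le) fun x _ => hM x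
  -- The first summand serves increments below `t₀`, where the power bound on `u` applies. For
  -- larger increments the trivial bound `2 * N` suffices, since then `1 ≤ (|t - s| / t₀) ^ β`.
  refine ⟨2 * M * (C / β) + 2 * N / t₀ ^ β, fun s t => ?_⟩
  wlog hst : s ≤ t generalizing s t
  · rw [norm_sub_rev, abs_sub_comm]
    exact this t s (le_of_not_ge hst)
  rw [abs_of_nonneg (sub_nonneg.2 hst), add_mul]
  have hd : 0 ≤ t - s := sub_nonneg.2 hst
  have hp : 0 ≤ (t - s) ^ β := Real.rpow_nonneg hd β
  have ht₀p : 0 < t₀ ^ β := Real.rpow_pos_of_pos ht₀ β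
  rcases lt_or_ge (t - s) t₀ with hlt | hge
  · refine le_add_of_le_of_nonneg ((norm_conv_sub_le (h.integrable_left l hl)
      (expWeight_nonneg h.nonneg) (fun r hr => expWeight_of_nonpos _ hr)
      (antitoneOn_expWeight hl.le h.nonneg h.antitone) hf hM hst).trans ?_) (by positivity)
    rw [mul_assoc (2 * M)]
    exact mul_le_mul_of_nonneg_left (h.integral_expWeight_le hl hβ hu_le hd hlt) (by positivity)
  · refine le_add_of_nonneg_of_le (by positivity) (((norm_sub_le _ _).trans
      (add_le_add (hNle t) (hNle s))).trans ?_)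
    rw [div_mul_eq_mul_div, le_div_iff₀ ht₀p, ← two_mul]
    exact mul_le_mul_of_nonneg_left (Real.rpow_le_rpow ht₀.le hge hβ.le) (by positivity)

/-- The exponential is Lipschitz on `[0,S]`, and a Lipschitz bound on a bounded interval gives a
Hölder bound through `d ≤ S ^ (1 - β) * d ^ β`. This is needed when the weight is removed from a
Hölder function. -/
lemma abs_exp_sub_exp_le {l S s t β : ℝ} (hl : 0 < l) (hβ1 : β < 1)
    (hs : s ∈ Icc 0 S) (ht : t ∈ Icc 0 S) :
    |Real.exp (l * t) - Real.exp (l * s)| ≤ Real.exp (l * S) * l * S ^ (1 - β) * |t - s| ^ β := by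
  wlog hst : s ≤ t generalizing s t
  · rw [abs_sub_comm, abs_sub_comm t s]
    exact this ht hs (le_of_not_ge hst)
  have hd : 0 ≤ t - s := sub_nonneg.2 hst
  have h1 : Real.exp (l * t) - Real.exp (l * s) ≤ Real.exp (l * S) * l * (t - s) := by
    have h2 := Real.add_one_le_exp (l * s - l * t)
    have h3 : Real.exp (l * s) = Real.exp (l * t) * Real.exp (l * s - l * t) := by
      rw [← Real.exp_add]
      ring_nf
    have h4 : Real.exp (l * t) ≤ Real.exp (l * S) := Real.exp_le_exp.2 (by nlinarith [ht.2])
    have h5 : 0 ≤ l * (t - s) := by positivity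
    have h6 := Real.exp_pos (l * t)
    nlinarith [mul_le_mul_of_nonneg_right h4 h5, mul_le_mul_of_nonneg_left h2 h6.le]
  have h7 : t - s ≤ S ^ (1 - β) * (t - s) ^ β := by
    rcases hd.eq_or_lt with h0 | h0
    · rw [← h0]
      exact mul_nonneg (Real.rpow_nonneg (hs.1.trans hs.2) _) (Real.rpow_nonneg le_rfl _)
    · calc t - s = (t - s) ^ (1 - β) * (t - s) ^ β := by
            rw [← Real.rpow_add h0, sub_add_cancel, Real.rpow_one]
        _ ≤ S ^ (1 - β) * (t - s) ^ β := by
            refine mul_le_mul_of_nonneg_right (Real.rpow_le_rpow hd ?_ (by linarith))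
              (Real.rpow_nonneg hd _)
            linarith [hs.1, ht.2]
  rw [abs_of_nonneg hd, abs_of_nonneg (sub_nonneg.2 (Real.exp_le_exp.2 (by nlinarith)))]
  refine h1.trans ?_
  rw [mul_assoc _ (S ^ (1 - β))]
  exact mul_le_mul_of_nonneg_left h7 (by positivity)

/-- Existence of a Hölder continuous solution of `k * v = ∫₀ᵗ (η + F v)`. -/
lemma exists_solution [CompleteSpace X] (h : IsSoninePair u k) {t₀ C β : ℝ} (ht₀ : 0 < t₀)
    (hC : 0 < C) (hβ : β ∈ Ioo (0 : ℝ) 1) (hu_le : ∀ t ∈ Ioo 0 t₀, u t ≤ C * t ^ (β - 1))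
    (F : X →L[ℝ] X) (η : X) :
    ∃ v : ℝ → X, Continuous v ∧ (∀ x ≤ 0, v x = 0) ∧
      (∀ S, ∃ L, ∀ t ∈ Icc 0 S, ∀ s ∈ Icc 0 S, ‖v t - v s‖ ≤ L * |t - s| ^ β) ∧
      ∀ t, 0 ≤ t → IntervalIntegrable (fun s => k (t - s) • v s) volume 0 t ∧
        ∫ s in (0 : ℝ)..t, k (t - s) • v s = ∫ s in (0 : ℝ)..t, (η + F (v s)) := by
  obtain ⟨l, hl, hlF⟩ := h.exists_weight F
  have hu := h.integrable_left l hl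
  have hk := h.integrable_right l hl
  have hu_nn := expWeight_nonneg (l := l) h.nonneg
  have hu0 : ∀ r < 0, expWeight l u r = 0 := fun r hr => expWeight_of_nonpos _ hr.le
  set p : ℝ → X := fun x => expWeight l (fun _ => 1) x • η with hp
  have hp0 : ∀ x ≤ 0, p x = 0 := fun x hx => by
    simp [hp, expWeight_of_nonpos _ hx]
  have hpm : AEStronglyMeasurable p :=
    (integrable_expWeight_one hl).aestronglyMeasurable.smul_const η
  have hpM : ∀ x, ‖p x‖ ≤ ‖η‖ := fun x => by
    rw [hp, norm_smul]
    exact mul_le_of_le_one_left (norm_nonneg _) (expWeight_one_le hl.le x)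
  obtain ⟨w, hwc, ⟨N, hN⟩, hwe⟩ := exists_eq_conv hu hu_nn hu0 F hlF hpm hpM
    fun x (hx : x ≠ 0) => (continuousAt_expWeight_one l hx).smul continuousAt_const
  -- The forcing `p` vanishes on `(-∞,0]`, so there `w` solves the homogeneous equation.
  have hw0 : ∀ x ≤ 0, w x = 0 := by
    refine eq_zero_of_eq_conv hu hu_nn hu0 F hlF (fun x _ => hN x) fun t ht => ?_
    rw [hwe t]
    refine conv_congr_Iic hu0 fun x hx => ?_
    rw [hp0 x (hx.trans ht), zero_add]
  set g : ℝ → X := fun x => p x + F (w x) with hg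
  have hgm : AEStronglyMeasurable g := hpm.add (F.continuous.comp hwc).aestronglyMeasurable
  have hgM : ∀ x, ‖g x‖ ≤ ‖η‖ + ‖F‖ * N := fun x =>
    norm_add_le_of_le (hpM x) ((F.le_opNorm _).trans
      (mul_le_mul_of_nonneg_left (hN x) (norm_nonneg _)))
  have hg0 : ∀ x ≤ 0, g x = 0 := fun x hx => by simp [hg, hp0 x hx, hw0 x hx]
  have hwe' : w = conv (expWeight l u) g := funext hwe
  have hwv : ∀ x, w x = Real.exp (-(l * x)) • Real.exp (l * x) • w x := fun x => by
    rw [smul_smul, ← Real.exp_add, neg_add_cancel, Real.exp_zero, one_smul]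
  refine ⟨fun x => Real.exp (l * x) • w x, by fun_prop, fun x hx => by simp [hw0 x hx],
    fun S => ?_, fun t ht => ⟨?_, ?_⟩⟩
  · obtain ⟨L, hL⟩ := h.norm_conv_sub_le_rpow hl ht₀ hC hβ.1 hu_le hgm hgM
    rw [← hwe'] at hL
    refine ⟨Real.exp (l * S) * L + Real.exp (l * S) * l * S ^ (1 - β) * N, fun t ht s hs => ?_⟩
    have hsplit : Real.exp (l * t) • w t - Real.exp (l * s) • w s
        = Real.exp (l * t) • (w t - w s) + (Real.exp (l * t) - Real.exp (l * s)) • w s := by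
      rw [smul_sub, sub_smul]
      abel
    rw [hsplit, add_mul]
    refine norm_add_le_of_le ?_ ?_
    · rw [norm_smul, Real.norm_of_nonneg (Real.exp_pos _).le, mul_assoc]
      exact mul_le_mul (Real.exp_le_exp.2 (mul_le_mul_of_nonneg_left ht.2 hl.le)) (hL s t)
        (norm_nonneg _) (Real.exp_pos _).le
    · rw [norm_smul, Real.norm_eq_abs, mul_right_comm]
      exact mul_le_mul (abs_exp_sub_exp_le hl hβ.2 hs ht) (hN s) (norm_nonneg _)
        ((abs_nonneg _).trans (abs_exp_sub_exp_le hl hβ.2 hs ht))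
  · exact intervalIntegrable_of_expWeight ht hk hw0 (fun x _ _ => hwv x)
      hwc.aestronglyMeasurable hN
  · have h1 : conv (expWeight l k) w t = conv (expWeight l fun _ => 1) g t := by
      rw [hwe', conv_assoc hk hu hgm hgM, conv_comm, conv_congr_left (h.conv_eq l hl)]
    rw [conv_expWeight_eq k ht hw0 (fun x _ _ => hwv x), conv_expWeight_eq (fun _ => 1) ht hg0
      (z := fun x => η + F (Real.exp (l * x) • w x)) fun x hx _ => ?_] at h1
    · simpa using h1
    · rw [smul_add, ← map_smul, ← hwv]
      simp [hg, hp, expWeight_of_pos _ hx]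

end IsSoninePair

/-! ### Positivity of the existence time -/

section Existence

/-- The existence time is positive when the potential measure has an integrable density near
`0`. -/
lemma IsPotentialDensity.existenceTime_pos {U : Measure ℝ} {u : ℝ → ℝ}
    (hu : IsPotentialDensity U u) (r : ℝ≥0) : 0 < existenceTime U r := by
  have hv : (r : ℝ≥0∞)⁻¹ ≠ 0 := ENNReal.inv_ne_zero.2 ENNReal.coe_ne_top
  have hfin : ∫⁻ x in Ioo 0 1, ENNReal.ofReal (u x) ≠ ⊤ := by
    have h := hu.integrable.2
    have hnn : 0 ≤ᵐ[volume.restrict (Ioo 0 1)] u := by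
      filter_upwards [ae_restrict_mem measurableSet_Ioo] with x hx using hu.nonneg x hx.1
    exact ((hasFiniteIntegral_iff_ofReal hnn).1 h).ne
  -- Absolute continuity of the integral: `U(0,x)` stays below `1/r` for small `x`, so every
  -- competitor in the infimum is at least `x`. For `r = 0` the threshold is `∞`.
  obtain ⟨δ, hδ, hsmall⟩ := exists_pos_setLIntegral_lt_of_measure_lt hfin hv
  obtain ⟨x, hx0, hx⟩ : ∃ x : ℝ≥0, 0 < x ∧ (x : ℝ≥0∞) < min δ 1 :=
    ENNReal.lt_iff_exists_nnreal_btwn.1 (lt_min hδ one_pos) |>.imp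
      fun x hx => ⟨by exact_mod_cast hx.1, hx.2⟩
  have hx1 : (x : ℝ) < 1 := by exact_mod_cast hx.trans_le (min_le_right _ _)
  have hU : U (Ioo 0 (x : ℝ)) < (r : ℝ≥0∞)⁻¹ := by
    rw [hu.density, withDensity_apply _ measurableSet_Ioo, Measure.restrict_restrict
      measurableSet_Ioo, inter_eq_left.2 Ioo_subset_Ioi_self]
    have h := hsmall (Ioo 0 (x : ℝ)) (lt_of_le_of_lt (Measure.restrict_apply_le _ _) ?_)
    · rwa [Measure.restrict_restrict measurableSet_Ioo,
        inter_eq_left.2 (Ioo_subset_Ioo_right hx1.le)] at h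
    · rw [Real.volume_Ioo, sub_zero, ENNReal.ofReal_coe_nnreal]
      exact hx.trans_le (min_le_left _ _)
  refine lt_of_lt_of_le (ENNReal.coe_pos.2 hx0) (le_iInf₂ fun y hy => ?_)
  by_contra hlt
  have hyx : (y : ℝ) ≤ x := by exact_mod_cast (not_le.1 hlt).le
  exact absurd hy (not_le.2 ((measure_mono (Ioo_subset_Ioo_right hyx)).trans_lt hU))

end Existence

/-! ### The Cauchy problem -/

section Cauchy

variable {X : Type*} [NormedAddCommGroup X] [NormedSpace ℝ X]

lemma IsHolder.continuousOn {X : Type*} [NormedAddCommGroup X] {β : ℝ} (hβ : 0 < β) {T : ℝ≥0∞}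
    {f : ℝ → X} (hf : IsHolder β T f) {t : ℝ}
    (ht : t ∈ timeInterval T) : ContinuousOn f (Icc 0 t) := by
  -- An intermediate `S` is finite even if `T = ∞`, and `[0,S)` still contains `t`.
  obtain ⟨S, htS, hST⟩ := exists_between ht.2
  obtain ⟨L, hL⟩ := hf S (hST.trans_le le_top) hST.le
  have hmem : ∀ x ∈ Icc 0 t, x ∈ timeInterval S := fun x hx =>
    ⟨hx.1, (ENNReal.ofReal_le_ofReal hx.2).trans_lt htS⟩
  intro x hx
  have hlim : Tendsto (fun y => L * |y - x| ^ β) (𝓝[Icc 0 t] x) (𝓝 0) := by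
    have hc : Continuous fun y : ℝ => L * |y - x| ^ β :=
      continuous_const.mul ((continuous_abs.comp (continuous_sub_right x)).rpow_const
        fun _ => Or.inr hβ.le)
    exact (hc.tendsto' x 0 (by simp [Real.zero_rpow hβ.ne'])).mono_left nhdsWithin_le_nhds
  refine tendsto_iff_norm_sub_tendsto_zero.2 (squeeze_zero' (Eventually.of_forall fun _ =>
    norm_nonneg _) ?_ hlim)
  filter_upwards [self_mem_nhdsWithin] with y hy using hL y (hmem y hy) x (hmem x hx)

lemma absolutelyContinuousOnInterval_integral [CompleteSpace X] {h : ℝ → X} (hh : Continuous h)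
    (a b : ℝ) : AbsolutelyContinuousOnInterval (fun t => ∫ s in (0 : ℝ)..t, h s) a b := by
  have hd : deriv (fun t => ∫ s in (0 : ℝ)..t, h s) = h :=
    funext fun t => (hh.integral_hasStrictDerivAt 0 t).hasDerivAt.deriv
  refine ContDiffOn.absolutelyContinuousOnInterval (ContDiff.contDiffOn ?_)
  rw [contDiff_one_iff_deriv, hd]
  exact ⟨fun t => (hh.integral_hasStrictDerivAt 0 t).hasDerivAt.differentiableAt, hh⟩

lemma absolutelyContinuousOnInterval_congr {X : Type*} [NormedAddCommGroup X] {f g : ℝ → X}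
    {a b : ℝ} (hf : AbsolutelyContinuousOnInterval f a b) (h : EqOn g f (uIcc a b)) :
    AbsolutelyContinuousOnInterval g a b := by
  rw [absolutelyContinuousOnInterval_iff] at hf ⊢
  intro ε hε
  obtain ⟨δ, hδ, H⟩ := hf ε hε
  refine ⟨δ, hδ, fun E hE hlen => ?_⟩
  rw [Finset.sum_congr rfl fun i hi => by rw [h (hE.1 i hi).1, h (hE.1 i hi).2]]
  exact H E hE hlen

lemma caputoIntegral_zero (ν : Measure ℝ) (f : ℝ → X) : caputoIntegral ν f 0 = 0 :=
  intervalIntegral.integral_same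

/-- A continuous almost everywhere solution satisfies the integrated equation. -/
lemma IsSolution.caputoIntegral_eq [CompleteSpace X] {ν : Measure ℝ} {G : X → X}
    (hG : Continuous G) {f₀ : X} {T : ℝ≥0∞} {g : ℝ → X} (hg : IsSolution ν G f₀ T g) {t : ℝ}
    (ht : t ∈ timeInterval T) (hc : ContinuousOn g (Icc 0 t)) :
    ∀ x ∈ Icc 0 t, caputoIntegral ν g x = ∫ s in (0 : ℝ)..x, G (g s) := by
  have ht0 : 0 ≤ t := ht.1
  -- Freezing `g` outside `[0,t]` at its endpoint values gives a function continuous on the whole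
  -- line.
  set c : ℝ → X := fun x => g (projIcc 0 t ht0 x) with hcdef
  have hcc : Continuous c := hc.comp_continuous (by fun_prop) fun x => (projIcc 0 t ht0 x).2
  have hcg : ∀ x ∈ Icc 0 t, c x = g x := fun x hx => by
    simp only [hcdef, projIcc_of_mem ht0 hx]
  have hGc : Continuous fun x => G (c x) := hG.comp hcc
  obtain ⟨A, hA⟩ := AbsolutelyContinuousOnInterval.const_of_ae_hasDerivAt_zero
    (f := caputoIntegral ν g - fun x => ∫ s in (0 : ℝ)..x, G (c s)) (a := 0) (b := t)
    ((hg.absCont t ht).sub (absolutelyContinuousOnInterval_integral hGc 0 t)) (by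
      -- At `0` only a one-sided derivative is available; this point is discarded as a null set.
      have hne : ∀ᵐ x : ℝ, x ≠ 0 := by simp [ae_iff]
      filter_upwards [hg.eqn, hne] with x hx hx0 hxt
      rw [uIcc_of_le ht0] at hxt
      have hx1 : HasDerivAt (caputoIntegral ν g) (G (g x)) x :=
        (hx ⟨hxt.1, (ENNReal.ofReal_le_ofReal hxt.2).trans_lt ht.2⟩).hasDerivAt
          (Ici_mem_nhds (lt_of_le_of_ne hxt.1 hx0.symm))
      have hx2 := (hGc.integral_hasStrictDerivAt 0 x).hasDerivAt
      rw [hcg x hxt] at hx2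
      simpa using hx1.sub hx2)
  rw [uIcc_of_le ht0] at hA
  intro x hx
  have h1 := (hA x hx).trans (hA 0 ⟨le_rfl, ht0⟩).symm
  simp only [Pi.sub_apply, caputoIntegral_zero, intervalIntegral.integral_same, sub_self] at h1
  rw [sub_eq_zero.1 h1]
  refine intervalIntegral.integral_congr fun s hs => ?_
  rw [uIcc_of_le hx.1] at hs
  simp only [hcg s ⟨hs.1, hs.2.trans hx.2⟩]

/-- Uniqueness of continuous almost everywhere solutions. -/
lemma IsSolution.eq_of_isSoninePair [CompleteSpace X] {ν : Measure ℝ} {u : ℝ → ℝ}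
    (hp : IsSoninePair u (tail ν)) (F : X →L[ℝ] X) {ξ f₀ : X} {T : ℝ≥0∞} {f g : ℝ → X}
    (hf : IsSolution ν (fun x => ξ + F x) f₀ T f) (hg : IsSolution ν (fun x => ξ + F x) f₀ T g)
    {t : ℝ} (ht : t ∈ timeInterval T) (hfc : ContinuousOn f (Icc 0 t))
    (hgc : ContinuousOn g (Icc 0 t)) : g t = f t := by
  have ht0 : 0 ≤ t := ht.1
  set z : ℝ → X := fun x => g (projIcc 0 t ht0 x) - f (projIcc 0 t ht0 x) with hz
  have hzc : Continuous z :=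
    (hgc.comp_continuous (by fun_prop) fun x => (projIcc 0 t ht0 x).2).sub
      (hfc.comp_continuous (by fun_prop) fun x => (projIcc 0 t ht0 x).2)
  have hz1 : ∀ x ∈ Icc 0 t, z x = g x - f x := fun x hx => by
    simp only [hz, projIcc_of_mem ht0 hx]
  have hz0 : ∀ x ≤ 0, z x = 0 := fun x hx => by
    simp only [hz, projIcc_of_le_left ht0 hx, hf.init, hg.init, sub_self]
  obtain ⟨N, hN⟩ := isCompact_Icc.exists_bound_of_continuousOn (hgc.sub hfc)
  have hG : Continuous fun x => ξ + F x := by fun_prop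
  have h := hp.eq_zero_of_integral_eq F (T := t) hzc hz0 (N := N)
    (fun x => hN _ (projIcc 0 t ht0 x).2) (fun x hx0 hxt => ?_) t le_rfl
  · rw [hz1 t ⟨ht0, le_rfl⟩] at h
    exact sub_eq_zero.1 h
  · have hxT : x ∈ timeInterval T := ⟨hx0, (ENNReal.ofReal_le_ofReal hxt).trans_lt ht.2⟩
    have hint : ∀ {c : ℝ → X}, ContinuousOn c (Icc 0 t) →
        IntervalIntegrable (fun s => ξ + F (c s)) volume 0 x := fun hc =>
      ((hG.comp_continuousOn hc).mono (Icc_subset_Icc_right hxt)).intervalIntegrable_of_Icc hx0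
    have h1 : ∫ s in (0 : ℝ)..x, tail ν (x - s) • z s
        = caputoIntegral ν g x - caputoIntegral ν f x := by
      rw [caputoIntegral, caputoIntegral, ← intervalIntegral.integral_sub (hg.integrable x hxT)
        (hf.integrable x hxT)]
      refine intervalIntegral.integral_congr fun s hs => ?_
      rw [uIcc_of_le hx0] at hs
      simp only [hz1 s ⟨hs.1, hs.2.trans hxt⟩, hf.init, hg.init, ← smul_sub,
        sub_sub_sub_cancel_right]
    rw [h1, hg.caputoIntegral_eq hG ht hgc x ⟨hx0, hxt⟩,
      hf.caputoIntegral_eq hG ht hfc x ⟨hx0, hxt⟩,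
      ← intervalIntegral.integral_sub (hint hgc) (hint hfc)]
    refine intervalIntegral.integral_congr fun s hs => ?_
    rw [uIcc_of_le hx0] at hs
    simp only [hz1 s ⟨hs.1, hs.2.trans hxt⟩, map_sub, add_sub_add_left_eq_sub]

/-- Existence of a solution on `[0,∞)` that is Hölder continuous on bounded intervals. -/
lemma IsSoninePair.exists_isSolution [CompleteSpace X] {ν : Measure ℝ} {u : ℝ → ℝ}
    (hp : IsSoninePair u (tail ν)) {t₀ C β : ℝ} (ht₀ : 0 < t₀) (hC : 0 < C)
    (hβ : β ∈ Ioo (0 : ℝ) 1) (hu_le : ∀ t ∈ Ioo 0 t₀, u t ≤ C * t ^ (β - 1))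
    (F : X →L[ℝ] X) (ξ f₀ : X) (T : ℝ≥0∞) :
    ∃ f : ℝ → X, IsHolder β T f ∧ IsSolution ν (fun x => ξ + F x) f₀ T f ∧
      ∀ t, 0 ≤ t → HasCaputoDerivAt ν f (ξ + F (f t)) t := by
  -- The solution is `f = f₀ + v` with `v 0 = 0`; the constant `F f₀` is absorbed into the forcing
  -- term.
  obtain ⟨v, hvc, hv0, hvH, hv⟩ := hp.exists_solution ht₀ hC hβ hu_le F (ξ + F f₀)
  have hsub : ∀ x, f₀ + v x - (f₀ + v 0) = v x := fun x => by simp [hv0 0 le_rfl]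
  have hcap : ∀ t, 0 ≤ t → caputoIntegral ν (fun x => f₀ + v x) t
      = ∫ s in (0 : ℝ)..t, (ξ + F f₀ + F (v s)) := fun t ht => by
    simp only [caputoIntegral, hsub, (hv t ht).2]
  have hhc : Continuous fun s => ξ + F f₀ + F (v s) := by fun_prop
  have hder : ∀ t, 0 ≤ t → HasCaputoDerivAt ν (fun x => f₀ + v x) (ξ + F (f₀ + v t)) t := by
    intro t ht
    rw [map_add, ← add_assoc]
    exact (hhc.integral_hasStrictDerivAt 0 t).hasDerivAt.hasDerivWithinAt.congr
      (fun x hx => hcap x hx) (hcap t ht)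
  refine ⟨fun x => f₀ + v x, ?_, ⟨?_, ?_, ?_, ?_⟩, hder⟩
  · intro S hS _
    obtain ⟨L, hL⟩ := hvH S.toReal
    have hmem : ∀ x ∈ timeInterval S, x ∈ Icc 0 S.toReal := fun x hx =>
      ⟨hx.1, (ENNReal.ofReal_le_iff_le_toReal hS.ne).1 hx.2.le⟩
    refine ⟨L, fun t ht s hs => ?_⟩
    rw [add_sub_add_left_eq_sub]
    exact hL t (hmem t ht) s (hmem s hs)
  · simp [hv0 0 le_rfl]
  · intro t ht
    simp only [hsub]
    exact (hv t ht.1).1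
  · intro t ht
    refine absolutelyContinuousOnInterval_congr (absolutelyContinuousOnInterval_integral hhc 0 t)
      fun x hx => hcap x ?_
    rw [uIcc_of_le ht.1] at hx
    exact hx.1
  · exact Eventually.of_forall fun t ht => hder t ht.1

end Cauchy

/-! ### The Sonine pair of a special subordinator -/

section Bernstein

lemma IsSpecialBernstein.pos {Φ : ℝ → ℝ} (hΦ : IsSpecialBernstein Φ) {l : ℝ} (hl : 0 < l) :
    0 < Φ l :=
  lt_of_le_of_ne (hΦ.bernstein.nonneg l hl) (hΦ.ne_zero l hl).symm

/-- The potential density and the tail of the Lévy measure of a special subordinator form a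
Sonine pair. -/
lemma IsPotentialDensity.isSoninePair {Φ : ℝ → ℝ} (hΦ : IsSpecialBernstein Φ) {ν : Measure ℝ}
    (hν : IsLevyTriplet Φ 0 0 ν) {Ω : Type*} [MeasurableSpace Ω] {P : Measure Ω}
    [IsProbabilityMeasure P] {σ : ℝ≥0 → Ω → ℝ} (hσ : IsSubordinator P σ)
    (hσΦ : HasLaplaceExponent P σ Φ) {u : ℝ → ℝ}
    (hu : IsPotentialDensity (potentialMeasure P σ) u) : IsSoninePair u (tail ν) where
  nonneg := hu.nonneg
  antitone := hu.antitone
  integrable_left l hl := (hu.expWeight hσ hσΦ hl (hΦ.pos hl)).1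
  integrable_right l hl := (hν.expWeight_tail hl).1
  conv_eq l hl := conv_expWeight_ae_eq_one hu.nonneg (fun x _ => tail_nonneg x)
    (fun l hl => (hu.expWeight hσ hσΦ hl (hΦ.pos hl)).1) (fun l hl => (hν.expWeight_tail hl).1)
    (fun l hl => by
      rw [(hu.expWeight hσ hσΦ hl (hΦ.pos hl)).2, (hν.expWeight_tail hl).2]
      have := (hΦ.pos hl).ne'
      field_simp) hl

end Bernstein

end GenCaputo

end

open GenCaputo in
theorem corollary3p2
    {X : Type*} [NormedAddCommGroup X] [NormedSpace ℝ X] [CompleteSpace X]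
    -- a special Bernstein function with Lévy triplet `(0, 0, ν)`, where `ν(0,∞) = ∞`
    (Φ : ℝ → ℝ) (hΦ : IsSpecialBernstein Φ)
    (ν : Measure ℝ) (hν : IsLevyTriplet Φ 0 0 ν) (hν_top : ν (Ioi 0) = ⊤)
    -- its subordinator, and the density of the potential measure
    {Ω : Type*} [MeasurableSpace Ω] (P : Measure Ω) [IsProbabilityMeasure P]
    (σ : ℝ≥0 → Ω → ℝ) (hσ : IsSubordinator P σ) (hσΦ : HasLaplaceExponent P σ Φ)
    (u : ℝ → ℝ) (hu : IsPotentialDensity (potentialMeasure P σ) u)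
    (t₀ C β : ℝ) (ht₀ : 0 < t₀) (hC : 0 < C) (hβ : β ∈ Ioo (0 : ℝ) 1)
    (hu_le : ∀ t ∈ Ioo 0 t₀, u t ≤ C * t ^ (β - 1)) :
    (∀ r : ℝ≥0, 0 < existenceTime (potentialMeasure P σ) r) ∧
    ∀ (F : X →L[ℝ] X) (ξ f₀ : X) (T : ℝ≥0∞),
      0 < T → T ≤ existenceTime (potentialMeasure P σ) ‖F‖ₑ →
      ∃ f : ℝ → X,
        IsHolder β T f ∧
        IsSolution ν (fun x => ξ + F x) f₀ T f ∧
        (∀ t ∈ timeInterval T, HasCaputoDerivAt ν f (ξ + F (f t)) t) ∧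
        ∀ g : ℝ → X, IsHolder β T g → IsSolution ν (fun x => ξ + F x) f₀ T g →
          EqOn g f (timeInterval T) := by
  have hp := hu.isSoninePair hΦ hν hσ hσΦ
  refine ⟨hu.existenceTime_pos, fun F ξ f₀ T _ _ => ?_⟩
  obtain ⟨f, hfH, hfS, hfD⟩ := hp.exists_isSolution ht₀ hC hβ hu_le F ξ f₀ T
  exact ⟨f, hfH, hfS, fun t ht => hfD t ht.1, fun g hgH hgS t ht =>
    hfS.eq_of_isSoninePair hp F hgS ht (hfH.continuousOn hβ.1 ht) (hgH.continuousOn hβ.1 ht)⟩
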